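/- **Setting.** Let $S_0$ be a gyrostat of mass $m_0>0$ with tensor of inertia $\mathrm{diag}(A_0,A_0,C_0)$ and gyrostatic momentum $(0,0,l)$. Let $S_1,S_2$ be rigid bodies of masses $m_1,m_2>0$ with tensors $\mathbb I_i=\mathrm{diag}(A_i,A_i,C_i)$; all $A_i,C_i$ and $G$ are positive. Put $M_2=m_1+m_2$, $M_1=M_2+m_0$, $g_1=\frac{m_1m_2}{M_2}$, $g_2=\frac{m_0M_2}{M_1}$, $\beta_i=\frac32(C_i-A_i)$ $(i=1,2)$, $r_{01}=\mu-\frac{m_2}{M_2}\lambda$ and $r_{02}=\mu+\frac{m_1}{M_2}\lambda$. The potential is $$\mathcal V=-\frac{Gm_1m_2}{|\lambda|}-\sum_{i=1,2}\Bigl(\frac{Gm_im_0}{|r_{0i}|}+\frac{Gm_0(2A_i+C_i)}{2|r_{0i}|^3}-\frac{3Gm_0\,r_{0i}\cdot\mathbb I_ir_{0i}}{2|r_{0i}|^5}\Bigr).$$ On states $z=(\Pi_1,\Pi_2,\Pi_0,\lambda,p_\lambda,\mu,p_\mu)\in\mathbb R^{21}$, with $\Pi_0=\mathrm{diag}(A_0,A_0,C_0)\,\Omega_0+(0,0,l)$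 and $\Pi_i=\mathbb I_i\Omega_i$ $(i=1,2)$, the equations of motion are $$\dot\Pi_0=\Pi_0\times\Omega_0+\lambda\times\nabla_\lambda\mathcal V+\mu\times\nabla_\mu\mathcal V,\qquad \dot\Pi_i=\Pi_i\times\Omega_i\ (i=1,2),$$ $$\dot\lambda=\tfrac{p_\lambda}{g_1}+\lambda\times\Omega_0,\quad \dot p_\lambda=p_\lambda\times\Omega_0-\nabla_\lambda\mathcal V,\quad \dot\mu=\tfrac{p_\mu}{g_2}+\mu\times\Omega_0,\quad \dot p_\mu=p_\mu\times\Omega_0-\nabla_\mu\mathcal V .$$ A curve of states $m_0\mapsto z(m_0)$ is a *relative equilibrium to first order in $m_0$* if all components of the right-hand sides along it are $o(m_0)$ as $m_0\to0^+$. Fix $a>0$. The curve is *Eulerian, in configuration $S_2S_1S_0$, with ratio $\rho>0$ and $|\lambda|=a$*, if moreover, for all small $m_0>0$, $|\lambda|=a$, $\lambda$ is perpendicular to the third axis, $\mu-\frac{m_2}{M_2}\lambda=\rho\lambda$ and $\Omega_0\perp\lambda$. The 2-parametric family attached to $\rho$ (for either sense of rotation, that is, either sign of $\omega_0$), with the spins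 $\omega_1,\omega_2\in\mathbb R$ of $S_1,S_2$ as parameters, consists of the curves $$\lambda=(a,0,0),\quad \mu=(\bar\mu,0,0),\quad \bar\mu=\tfrac{(1+\rho)m_2+\rho m_1}{M_2}a,\quad p_\lambda=(0,g_1\omega_0a,0),\quad p_\mu=(0,g_2\omega_0\bar\mu,0),$$ $$\Pi_0=(0,0,C_0\omega_0+l),\quad \Pi_i=(0,0,C_i\omega_i)\ (i=1,2),\quad \omega_0^2=\tfrac{M_2}{m_1m_2}h_1(\rho),$$ where $$h_1(\rho)=\frac{Gm_1m_2}{a^3}+\frac{Gm_0m_1}{M_2a^3}\Bigl(\frac{m_2}{(1+\rho)^2}+\frac{\beta_2}{(1+\rho)^4a^2}\Bigr)-\frac{Gm_0m_2}{M_2a^3}\Bigl(\frac{m_1}{\rho^2}+\frac{\beta_1}{\rho^4a^2}\Bigr).$$ "There are exactly $n$ families" means that exactly $n$ ratios $\rho>0$ occur for Eulerian relative equilibria to first order in $m_0$, in configuration $S_2S_1S_0$ with $|\lambda|=a$, and that for each of these ratios all the curves of the family attached to it are such equilibria. Let $\beta_1=k\beta_2$, $\nu=\frac{m_2}{m_1+m_2}$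 and, for $\rho>0$, $$p_1(\rho)=\rho^5+(2+\nu)\rho^4+(1+2\nu)\rho^3-(1-\nu)\rho^2-2(1-\nu)\rho-(1-\nu),$$ $$q_1(\rho)=(1+k)\rho^4+4k\rho^3+6k\rho^2+4k\rho+k,\qquad R_1(\rho)=\frac{(m_1+m_2)\,a^2\rho^2(\rho+1)^2p_1(\rho)}{q_1(\rho)}.$$ **Proposition 6 (Eulerian bifurcations, configuration $S_2S_1S_0$).** There is exactly one $k_0\in\mathbb R$ such that, for $k=k_0$, $p_1$ and $q_1$ have a common root in $(0,\infty)$, and $-1<k_0<0$. To first order in $m_0$ the following hold in configuration $S_2S_1S_0$ with $|\lambda|=a$. a) If $k>0$, then $R_1$ has exactly one local minimum point in $(0,\infty)$, with value $\xi_2(k)<0$. There are no families if $\beta_2<\xi_2(k)$; exactly one if $\beta_2=\xi_2(k)$; exactly two if $\xi_2(k)<\beta_2<0$; exactly one if $\beta_2>0$. b) If $k<k_0$ and $\beta_2>0$: $R_1$ has exactly one local maximum point in $(0,\infty)$, with value $\xi_1(k)>0$. If $k>-1$, it has exactly one local minimum point in $(0,\infty)$, with value $\xi_2(k)>\xi_1(k)$;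 if $k\le-1$ it has none, and $\xi_2(k)=+\infty$. There are no families if $\xi_1(k)<\beta_2<\xi_2(k)$; exactly one if $\beta_2=\xi_1(k)$ or $\beta_2=\xi_2(k)$; exactly two if $\beta_2>\xi_2(k)$; exactly two if $0<\beta_2<\xi_1(k)$. c) If $k<k_0$ and $\beta_2<0$, there is exactly one family. d) If $k_0<k<0$ and $\beta_2>0$, there are exactly two families. e) If $k_0<k<0$ and $\beta_2<0$, there is exactly one family. -/

import Mathlib

open Filter Topology Asymptotics

noncomputable section

/-- Euclidean three-space (vectors are expressed in the body frame of the gyrostat). -/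
abbrev E3 : Type := EuclideanSpace ℝ (Fin 3)

/-- The cross product on `E3`. -/
def cross (u v : E3) : E3 := WithLp.toLp 2 (crossProduct u.ofLp v.ofLp)

/-- The action of the diagonal tensor `diag(A, A, C)`. -/
def diagAct (A C : ℝ) (v : E3) : E3 := !₂[A * v 0, A * v 1, C * v 2]

/-- The constants of the problem of a gyrostat `S₀` and two rigid bodies `S₁`, `S₂` with symmetry of
revolution, except the mass `m₀` of the gyrostat, which is kept as a variable.  The tensor of inertia
of `Sᵢ` is `diag(Aᵢ, Aᵢ, Cᵢ)`, and `(0, 0, l)` is the gyrostatic momentum. -/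
structure GyrostatSystem where
  G : ℝ
  m₁ : ℝ
  m₂ : ℝ
  A₀ : ℝ
  C₀ : ℝ
  A₁ : ℝ
  C₁ : ℝ
  A₂ : ℝ
  C₂ : ℝ
  l : ℝ
  G_pos : 0 < G
  m₁_pos : 0 < m₁
  m₂_pos : 0 < m₂
  A₀_pos : 0 < A₀
  C₀_pos : 0 < C₀
  A₁_pos : 0 < A₁
  C₁_pos : 0 < C₁
  A₂_pos : 0 < A₂
  C₂_pos : 0 < C₂

/-- A point of the twice reduced phase space `ℝ²¹`. -/
structure State where
  Pi₁ : E3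
  Pi₂ : E3
  Pi₀ : E3
  lam : E3
  pLam : E3
  mu : E3
  pMu : E3

namespace GyrostatSystem

variable (S : GyrostatSystem)

/-- `M₂ = m₁ + m₂`. -/
def M₂ : ℝ := S.m₁ + S.m₂

/-- `M₁ = m₁ + m₂ + m₀`. -/
def M₁ (m₀ : ℝ) : ℝ := S.m₁ + S.m₂ + m₀

/-- The reduced mass `g₁ = m₁ m₂ / M₂`. -/
def g₁ : ℝ := S.m₁ * S.m₂ / S.M₂

/-- The reduced mass `g₂ = m₀ M₂ / M₁`. -/
def g₂ (m₀ : ℝ) : ℝ := m₀ * S.M₂ / S.M₁ m₀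

/-- `β₁ = 3 (C₁ - A₁) / 2`. -/
def β₁ : ℝ := 3 * (S.C₁ - S.A₁) / 2

/-- `β₂ = 3 (C₂ - A₂) / 2`. -/
def β₂ : ℝ := 3 * (S.C₂ - S.A₂) / 2

/-- The vector `μ - (m₂ / M₂) λ` from `S₁` to `S₀`. -/
def r₀₁ (lam mu : E3) : E3 := mu - (S.m₂ / S.M₂) • lam

/-- The vector `μ + (m₁ / M₂) λ` from `S₂` to `S₀`. -/
def r₀₂ (lam mu : E3) : E3 := mu + (S.m₁ / S.M₂) • lam

/-- The point-mass part of the potential. -/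
def potential₁ (m₀ : ℝ) (lam mu : E3) : ℝ :=
  -(S.G * S.m₁ * S.m₂ / ‖lam‖ + S.G * S.m₁ * m₀ / ‖S.r₀₁ lam mu‖
    + S.G * S.m₂ * m₀ / ‖S.r₀₂ lam mu‖)

/-- The part of the potential due to the shapes of `S₁` and `S₂`, where `αᵢ = 2 Aᵢ + Cᵢ` and
`fᵢ = r₀ᵢ ⬝ diag(Aᵢ, Aᵢ, Cᵢ) r₀ᵢ`. -/
def potential₂ (m₀ : ℝ) (lam mu : E3) : ℝ :=
  -(1 / 2) *
    (S.G * m₀ * (2 * S.A₁ + S.C₁) / ‖S.r₀₁ lam mu‖ ^ 3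
      + S.G * m₀ * (2 * S.A₂ + S.C₂) / ‖S.r₀₂ lam mu‖ ^ 3
      - 3 * S.G * m₀ * inner ℝ (S.r₀₁ lam mu) (diagAct S.A₁ S.C₁ (S.r₀₁ lam mu))
          / ‖S.r₀₁ lam mu‖ ^ 5
      - 3 * S.G * m₀ * inner ℝ (S.r₀₂ lam mu) (diagAct S.A₂ S.C₂ (S.r₀₂ lam mu))
          / ‖S.r₀₂ lam mu‖ ^ 5)

/-- The approximate potential of the system. -/
def potential (m₀ : ℝ) (lam mu : E3) : ℝ := S.potential₁ m₀ lam mu + S.potential₂ m₀ lam mu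

/-- The gradient of the potential with respect to `λ`. -/
def gradLam (m₀ : ℝ) (lam mu : E3) : E3 := gradient (fun x => S.potential m₀ x mu) lam

/-- The gradient of the potential with respect to `μ`. -/
def gradMu (m₀ : ℝ) (lam mu : E3) : E3 := gradient (fun x => S.potential m₀ lam x) mu

/-- The angular velocity of the gyrostat, determined by `Π₀ = 𝕀₀ Ω₀ + (0, 0, l)`. -/
def Ω₀ (z : State) : E3 := diagAct S.A₀⁻¹ S.C₀⁻¹ (z.Pi₀ - !₂[0, 0, S.l])

/-- The angular velocity of `S₁`, determined by `Π₁ = 𝕀₁ Ω₁`. -/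
def Ω₁ (z : State) : E3 := diagAct S.A₁⁻¹ S.C₁⁻¹ z.Pi₁

/-- The angular velocity of `S₂`, determined by `Π₂ = 𝕀₂ Ω₂`. -/
def Ω₂ (z : State) : E3 := diagAct S.A₂⁻¹ S.C₂⁻¹ z.Pi₂

/-- The right-hand side of the equations of motion `dz/dt = {z, H}` for the mass `m₀` of the
gyrostat. -/
def field (m₀ : ℝ) (z : State) : State where
  Pi₁ := cross z.Pi₁ (S.Ω₁ z)
  Pi₂ := cross z.Pi₂ (S.Ω₂ z)
  Pi₀ := cross z.Pi₀ (S.Ω₀ z) + cross z.lam (S.gradLam m₀ z.lam z.mu)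
    + cross z.mu (S.gradMu m₀ z.lam z.mu)
  lam := (S.g₁)⁻¹ • z.pLam + cross z.lam (S.Ω₀ z)
  pLam := cross z.pLam (S.Ω₀ z) - S.gradLam m₀ z.lam z.mu
  mu := (S.g₂ m₀)⁻¹ • z.pMu + cross z.mu (S.Ω₀ z)
  pMu := cross z.pMu (S.Ω₀ z) - S.gradMu m₀ z.lam z.mu

/-- `m₀ ↦ z m₀` is a relative equilibrium to first order in `m₀`: along it, every component of the
right-hand side of the equations of motion is `o(m₀)` as `m₀ → 0⁺`. -/
def IsFirstOrderEquilibrium (z : ℝ → State) : Prop :=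
  (fun m₀ => (S.field m₀ (z m₀)).Pi₁) =o[𝓝[>] (0 : ℝ)] (fun m₀ => m₀) ∧
  (fun m₀ => (S.field m₀ (z m₀)).Pi₂) =o[𝓝[>] (0 : ℝ)] (fun m₀ => m₀) ∧
  (fun m₀ => (S.field m₀ (z m₀)).Pi₀) =o[𝓝[>] (0 : ℝ)] (fun m₀ => m₀) ∧
  (fun m₀ => (S.field m₀ (z m₀)).lam) =o[𝓝[>] (0 : ℝ)] (fun m₀ => m₀) ∧
  (fun m₀ => (S.field m₀ (z m₀)).pLam) =o[𝓝[>] (0 : ℝ)] (fun m₀ => m₀) ∧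
  (fun m₀ => (S.field m₀ (z m₀)).mu) =o[𝓝[>] (0 : ℝ)] (fun m₀ => m₀) ∧
  (fun m₀ => (S.field m₀ (z m₀)).pMu) =o[𝓝[>] (0 : ℝ)] (fun m₀ => m₀)

/-- The geometry of an Eulerian relative equilibrium in the configuration `S₂S₁S₀` with
`|λ| = a` and ratio `ρ > 0`: the line of the centers of mass is perpendicular to the axes of
symmetry, `S₁` lies between `S₂` and `S₀` with `μ - (m₂ / M₂) λ = ρ λ`, and the angular velocity of
the gyrostat is perpendicular to that line. -/
def IsEulerS₂S₁S₀ (a ρ : ℝ) (z : State) : Prop :=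
  0 < ρ ∧ ‖z.lam‖ = a ∧ z.lam 2 = 0 ∧ S.r₀₁ z.lam z.mu = ρ • z.lam ∧ inner ℝ (S.Ω₀ z) z.lam = 0

/-- `m₀ ↦ z m₀` is, to first order in `m₀`, an Eulerian relative equilibrium in the configuration
`S₂S₁S₀` with `|λ| = a` and ratio `ρ`. -/
def IsFirstOrderEulerian (a ρ : ℝ) (z : ℝ → State) : Prop :=
  (∀ᶠ m₀ in 𝓝[>] (0 : ℝ), S.IsEulerS₂S₁S₀ a ρ (z m₀)) ∧ S.IsFirstOrderEquilibrium z

/-- The ratios `ρ` of the Eulerian relative equilibria, to first order in `m₀`, in the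
configuration `S₂S₁S₀` with `|λ| = a`. -/
def eulerRatios (a : ℝ) : Set ℝ := {ρ | ∃ z : ℝ → State, S.IsFirstOrderEulerian a ρ z}

/-- The scalar `h₁(ρ)`, for `ρ > 0`, with `∇_λ V = h₁(ρ) λ` on collinear configurations. -/
def h₁ (a m₀ ρ : ℝ) : ℝ :=
  S.G * S.m₁ * S.m₂ / a ^ 3
    + S.G * m₀ * S.m₁ / (S.M₂ * a ^ 3) * (S.m₂ / (1 + ρ) ^ 2 + S.β₂ / ((1 + ρ) ^ 4 * a ^ 2))
    - S.G * m₀ * S.m₂ / (S.M₂ * a ^ 3) * (S.m₁ / ρ ^ 2 + S.β₁ / (ρ ^ 4 * a ^ 2))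

/-- The angular velocity `ω₀` with `ω₀² = (m₁ + m₂) h₁(ρ) / (m₁ m₂)` and sign `s`. -/
def ω₀ (a ρ s m₀ : ℝ) : ℝ := s * √((S.m₁ + S.m₂) * S.h₁ a m₀ ρ / (S.m₁ * S.m₂))

/-- The abscissa `((1 + ρ) m₂ + ρ m₁) a / M₂` of `μ`. -/
def muAbs (a ρ : ℝ) : ℝ := ((1 + ρ) * S.m₂ + ρ * S.m₁) / S.M₂ * a

/-- The 2-parametric family of states attached to the ratio `ρ` (and to the sense of rotation
`s = ± 1`); the parameters are the spins `ω₁`, `ω₂` of `S₁`, `S₂`. -/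
def eulerFamily (a ρ s ω₁ ω₂ m₀ : ℝ) : State where
  Pi₁ := !₂[0, 0, S.C₁ * ω₁]
  Pi₂ := !₂[0, 0, S.C₂ * ω₂]
  Pi₀ := !₂[0, 0, S.C₀ * S.ω₀ a ρ s m₀ + S.l]
  lam := !₂[a, 0, 0]
  pLam := !₂[0, S.g₁ * S.ω₀ a ρ s m₀ * a, 0]
  mu := !₂[S.muAbs a ρ, 0, 0]
  pMu := !₂[0, S.g₂ m₀ * S.ω₀ a ρ s m₀ * S.muAbs a ρ, 0]

/-- To first order in `m₀` there are exactly `n` 2-parametric families of Eulerian relative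
equilibria in the configuration `S₂S₁S₀` with `|λ| = a`: the Eulerian relative equilibria have
exactly `n` different ratios `ρ`, and each of these ratios carries its whole family. -/
def HasExactlyFamilies (a : ℝ) (n : ℕ) : Prop :=
  (S.eulerRatios a).encard = n ∧
    ∀ ρ ∈ S.eulerRatios a, ∀ s : ℝ, (s = 1 ∨ s = -1) → ∀ ω₁ ω₂ : ℝ,
      S.IsFirstOrderEulerian a ρ (S.eulerFamily a ρ s ω₁ ω₂)

/-- The mass ratio `ν = m₂ / (m₁ + m₂)`. -/
def ν : ℝ := S.m₂ / (S.m₁ + S.m₂)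

/-- The polynomial `p₁` for `ρ > 0`. -/
def p₁ (ρ : ℝ) : ℝ :=
  ρ ^ 5 + (2 + S.ν) * ρ ^ 4 + (1 + 2 * S.ν) * ρ ^ 3 - (1 - S.ν) * ρ ^ 2
    - 2 * (1 - S.ν) * ρ - (1 - S.ν)

end GyrostatSystem

/-- The polynomial `q₁` for `ρ > 0`. -/
def q₁ (k ρ : ℝ) : ℝ := (1 + k) * ρ ^ 4 + 4 * k * ρ ^ 3 + 6 * k * ρ ^ 2 + 4 * k * ρ + k

/-- The rational function `R₁` for `ρ > 0`. -/
def GyrostatSystem.R₁ (S : GyrostatSystem) (a k ρ : ℝ) : ℝ :=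
  (S.m₁ + S.m₂) * a ^ 2 * ρ ^ 2 * (ρ + 1) ^ 2 * S.p₁ ρ / q₁ k ρ

/-- `ρ₀` is the only point of `(0, ∞)` at which `f` has a local minimum. -/
def IsOnlyLocalMin (f : ℝ → ℝ) (ρ₀ : ℝ) : Prop := ∀ ρ : ℝ, (0 < ρ ∧ IsLocalMin f ρ) ↔ ρ = ρ₀

/-- `ρ₀` is the only point of `(0, ∞)` at which `f` has a local maximum. -/
def IsOnlyLocalMax (f : ℝ → ℝ) (ρ₀ : ℝ) : Prop := ∀ ρ : ℝ, (0 < ρ ∧ IsLocalMax f ρ) ↔ ρ = ρ₀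

end

/-!
Let `λ = (a, 0, 0)` and let `S₀` sit at `ρ λ` from `S₁`, with all axes of symmetry perpendicular to the
line.  There the gradients of the potential are central: `∇_λ V = h₁(ρ) λ` and
`∇_μ V = m₀ * pull(ρ) * λ` (`gradLam_eq`, `gradMu_eq`).  Taking inner products with `λ`, the equations for
`(λ, p_λ)` give `|Ω₀|² → G M₂ / a³` as `m₀ → 0`, and the equations for `(μ, p_μ)`, divided by `m₀`, leave in
the limit the single condition `(ρ + ν) G M₂ / a³ = pull(ρ)`
(`pull_eq_of_isFirstOrderEulerian`).  Conversely this condition makes the whole family attached to `ρ` a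
first-order equilibrium (`isFirstOrderEulerian_eulerFamily`).  With the denominators cleared it reads
`balance(ρ) = (m₁ + m₂) a² ρ² (ρ + 1)² p₁(ρ) - β₂ q₁(ρ) = 0`, so the ratios are the positive zeros of a
polynomial (`eulerRatios_eq`); where `q₁ ≠ 0` the equation is `R₁(ρ) = β₂`.

Zeros are counted, for any value `b` of `β₂`, with the quotient `F_b = balance / ρ⁴`, whose derivative is a
positive function times `c * slope(ρ) + 4 b k`, where `c > 0` and `slope` increases from `0` to `∞`
(`hasDerivAt_balance_div`, `slope_strictMonoOn`).  If `b k > 0`, then `F_b` increases from `-∞` to `∞` and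
there is exactly one zero.  If `b k < 0`, then `F_b` decreases and then increases, with limit `∞` at both
ends, so it has two zeros as soon as it is negative somewhere.

The extrema of `R₁` follow from the same fact.  At a local extremum `r` of `R₁` with `q₁(r) ≠ 0` and value
`b`, both `F_b` and its derivative vanish, so `b k < 0` and `F_b > 0` away from `r`
(`balance_pos_of_isLocalExtr`).  As `ρ⁴ F_b = q₁ (R₁ - b)`, the value `b` is below all other values of `R₁`
where `q₁ > 0` and above all other values where `q₁ < 0`.  Hence there is at most one local extremum on
each of these two sets, its nature is determined by the sign of `q₁`, and the minimum value `ξ₂` exceeds the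
maximum value `ξ₁` when both exist.  Existence comes from Rolle's theorem.  Finally
`q₁ = ρ⁴ + k (1 + ρ)⁴` and `p₁ / (ρ² (1 + ρ)²)` is increasing, so `k₀ = -(ρ₁ / (1 + ρ₁))⁴` for the positive
zero `ρ₁` of `p₁`, and `k < k₀` means `q₁(ρ₁) < 0`.
-/

noncomputable section

/-! ### The polynomial `q₁` -/

theorem q₁_eq (k ρ : ℝ) : q₁ k ρ = ρ ^ 4 + k * (1 + ρ) ^ 4 := by
  unfold q₁; ring

theorem q₁_pos {k ρ : ℝ} (hk : 0 < k) (hρ : 0 ≤ ρ) : 0 < q₁ k ρ := by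
  rw [q₁_eq]; positivity

theorem q₁_neg_of_le_neg_one {k ρ : ℝ} (hk : k ≤ -1) (hρ : 0 ≤ ρ) : q₁ k ρ < 0 := by
  have h1 : ρ ^ 4 < (1 + ρ) ^ 4 := by gcongr; linarith
  have h2 : k * (1 + ρ) ^ 4 ≤ -1 * (1 + ρ) ^ 4 := by gcongr
  rw [q₁_eq]; linarith

theorem q₁_neg_iff {k ρ : ℝ} (hρ : 0 ≤ ρ) : q₁ k ρ < 0 ↔ k < -(ρ / (1 + ρ)) ^ 4 := by
  have hs : 0 < (1 + ρ) ^ 4 := by positivity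
  rw [q₁_eq, div_pow, ← neg_div, lt_div_iff₀ hs]
  constructor <;> intro h <;> linarith

theorem q₁_pos_iff {k ρ : ℝ} (hρ : 0 ≤ ρ) : 0 < q₁ k ρ ↔ -(ρ / (1 + ρ)) ^ 4 < k := by
  have hs : 0 < (1 + ρ) ^ 4 := by positivity
  rw [q₁_eq, div_pow, ← neg_div, div_lt_iff₀ hs]
  constructor <;> intro h <;> linarith

theorem q₁_eq_zero_iff {k ρ : ℝ} (hρ : 0 ≤ ρ) : q₁ k ρ = 0 ↔ k = -(ρ / (1 + ρ)) ^ 4 := by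
  have hs : 0 < (1 + ρ) ^ 4 := by positivity
  rw [q₁_eq, div_pow, ← neg_div, eq_div_iff hs.ne']
  constructor <;> intro h <;> linarith

theorem neg_div_pow_lt {x y : ℝ} (hx : 0 ≤ x) (hxy : x < y) :
    -(y / (1 + y)) ^ 4 < -(x / (1 + x)) ^ 4 := by
  have h : x / (1 + x) < y / (1 + y) := by
    rw [div_lt_div_iff₀ (by linarith) (by linarith)]; linarith
  have h0 : 0 ≤ x / (1 + x) := by positivity
  have := pow_lt_pow_left₀ h h0 (n := 4) (by norm_num)
  linarith

/-- On `(0, ∞)` the polynomial `q₁` changes sign at most once, from negative to positive. -/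
theorem q₁_neg_of_lt {k x y : ℝ} (hx : 0 ≤ x) (hxy : x < y) (h : q₁ k y ≤ 0) : q₁ k x < 0 := by
  rw [q₁_neg_iff hx]
  have h' : ¬ 0 < q₁ k y := not_lt.mpr h
  rw [q₁_pos_iff (hx.trans hxy.le)] at h'
  exact (not_lt.mp h').trans_lt (neg_div_pow_lt hx hxy)

theorem q₁_pos_of_lt {k x y : ℝ} (hx : 0 ≤ x) (hxy : x < y) (h : 0 ≤ q₁ k x) : 0 < q₁ k y := by
  by_contra hc
  exact absurd (q₁_neg_of_lt hx hxy (not_lt.mp hc)) (not_lt.mpr h)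

theorem exists_q₁_eq_zero {k : ℝ} (h1 : -1 < k) (h0 : k < 0) : ∃ ρ, 0 < ρ ∧ q₁ k ρ = 0 := by
  -- with `t = (-k) ^ (1 / 4) < 1`, the root solves `ρ / (1 + ρ) = t`
  have ht0 : 0 < √(√(-k)) := by
    rw [Real.sqrt_pos, Real.sqrt_pos]; linarith
  have ht4 : √(√(-k)) ^ 4 = -k := by
    rw [show (4 : ℕ) = 2 * 2 by norm_num, pow_mul, Real.sq_sqrt (Real.sqrt_nonneg _),
      Real.sq_sqrt (by linarith)]
  set t := √(√(-k)) with ht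
  have ht1 : t < 1 := by
    by_contra hc
    have := one_le_pow₀ (not_lt.mp hc) (n := 4)
    linarith
  have h1t : 0 < 1 - t := by linarith
  refine ⟨t / (1 - t), by positivity, ?_⟩
  rw [q₁_eq, show k = -t ^ 4 by linarith]
  field_simp
  ring

theorem continuous_q₁ (k : ℝ) : Continuous (q₁ k) := by
  unfold q₁; fun_prop

namespace GyrostatSystem

variable (S : GyrostatSystem)

/-! ### The polynomial `p₁` -/

theorem ν_pos : 0 < S.ν := div_pos S.m₂_pos (add_pos S.m₁_pos S.m₂_pos)

theorem ν_lt_one : S.ν < 1 := by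
  have := S.m₁_pos
  have := S.m₂_pos
  rw [ν, div_lt_one (by linarith)]; linarith

theorem continuous_p₁ : Continuous S.p₁ := by
  unfold p₁; fun_prop

/-- If `p₁` vanishes at `x`, it is positive to the right of `x`: `p₁(ρ) / (ρ² (1 + ρ)²)` increases. -/
theorem p₁_pos_of_lt {x y : ℝ} (hx : 0 ≤ x) (hxy : x < y) (h : 0 ≤ S.p₁ x) : 0 < S.p₁ y := by
  have hν := S.ν_pos
  have hν1 := S.ν_lt_one
  have hx0 : 0 < x := by
    rcases hx.eq_or_lt with rfl | h0
    · simp [p₁] at h; linarith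
    · exact h0
  have hy0 : 0 < y := hx0.trans hxy
  have key : ∀ r : ℝ, 0 < r →
      S.p₁ r = r ^ 2 * (1 + r) ^ 2 * (r + S.ν - (1 - S.ν) / r ^ 2 - S.ν / (1 + r) ^ 2) := by
    intro r hr
    have : 1 + r ≠ 0 := by positivity
    unfold p₁; field_simp; ring
  rw [key x hx0] at h
  rw [key y hy0]
  have h' := nonneg_of_mul_nonneg_right h (by positivity)
  have e1 : (1 - S.ν) / y ^ 2 ≤ (1 - S.ν) / x ^ 2 := by
    gcongr
  have e2 : S.ν / (1 + y) ^ 2 ≤ S.ν / (1 + x) ^ 2 := by gcongr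
  have : 0 < y + S.ν - (1 - S.ν) / y ^ 2 - S.ν / (1 + y) ^ 2 := by linarith
  positivity

theorem p₁_neg_of_lt {x y : ℝ} (hx : 0 ≤ x) (hxy : x < y) (h : S.p₁ y ≤ 0) : S.p₁ x < 0 := by
  by_contra hc
  exact absurd (S.p₁_pos_of_lt hx hxy (not_lt.mp hc)) (not_lt.mpr h)

theorem exists_p₁_eq_zero : ∃ ρ, 0 < ρ ∧ S.p₁ ρ = 0 := by
  have hν := S.ν_pos
  have hν1 := S.ν_lt_one
  have h0 : S.p₁ 0 < 0 := by simp [p₁]; linarith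
  have h1 : 0 ≤ S.p₁ 1 := by simp [p₁]; linarith
  obtain ⟨r, hr, hr0⟩ := intermediate_value_Icc zero_le_one S.continuous_p₁.continuousOn ⟨h0.le, h1⟩
  refine ⟨r, lt_of_le_of_ne hr.1 ?_, hr0⟩
  rintro rfl
  exact h0.ne hr0

/-! ### The shape of the balance of forces and the number of its zeros -/

/-- The polynomial in `ρ` whose positive zeros, for `b = β₂`, are the ratios of the Eulerian relative
equilibria to first order in `m₀`.  Where `q₁ ≠ 0`, its vanishing means `R₁ = b`. -/
def balance (a k b ρ : ℝ) : ℝ :=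
  (S.m₁ + S.m₂) * a ^ 2 * ρ ^ 2 * (ρ + 1) ^ 2 * S.p₁ ρ - b * q₁ k ρ

theorem continuous_balance (a k b : ℝ) : Continuous (S.balance a k b) := by
  have := S.continuous_p₁
  have := continuous_q₁ k
  unfold balance; fun_prop

theorem balance_zero (a k b : ℝ) : S.balance a k b 0 = -(b * k) := by
  simp [balance, q₁]

theorem balance_eq {a k b ρ : ℝ} (hq : q₁ k ρ ≠ 0) :
    S.balance a k b ρ = q₁ k ρ * (S.R₁ a k ρ - b) := by
  unfold balance R₁
  field_simp

/-- The increasing function of `ρ` that governs the sign of the derivative of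
`balance a k b ρ / ρ ^ 4`. -/
def slope (ρ : ℝ) : ℝ :=
  ρ ^ 5 * (1 + 5 * ρ + 4 * S.ν - 2 * S.ν / (1 + ρ) ^ 2) + (1 - S.ν) * (2 * ρ ^ 2 - 2 * ρ ^ 3)

/-- Dividing by `ρ ^ 4` removes the term `b ρ ^ 4` of `b * q₁` from the derivative, which then depends on
`b` and `k` only through the constant `b * k`. -/
theorem hasDerivAt_balance_div (a k b : ℝ) {ρ : ℝ} (hρ : 0 < ρ) :
    HasDerivAt (fun x => S.balance a k b x / x ^ 4)
      ((1 + ρ) ^ 3 / ρ ^ 5 * ((S.m₁ + S.m₂) * a ^ 2 * S.slope ρ + 4 * (b * k))) ρ := by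
  have hp : HasDerivAt S.p₁ (5 * ρ ^ 4 + (2 + S.ν) * (4 * ρ ^ 3) + (1 + 2 * S.ν) * (3 * ρ ^ 2)
      - (1 - S.ν) * (2 * ρ) - 2 * (1 - S.ν)) ρ := by
    unfold p₁
    refine ((((((hasDerivAt_pow 5 ρ).add ((hasDerivAt_pow 4 ρ).const_mul (2 + S.ν))).add
      ((hasDerivAt_pow 3 ρ).const_mul (1 + 2 * S.ν))).sub
      ((hasDerivAt_pow 2 ρ).const_mul (1 - S.ν))).sub
      ((hasDerivAt_id ρ).const_mul (2 * (1 - S.ν)))).sub_const (1 - S.ν)).congr_deriv ?_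
    norm_num
  have hq : HasDerivAt (q₁ k) ((1 + k) * (4 * ρ ^ 3) + 4 * k * (3 * ρ ^ 2) + 6 * k * (2 * ρ)
      + 4 * k) ρ := by
    unfold q₁
    refine ((((((hasDerivAt_pow 4 ρ).const_mul (1 + k)).add
      ((hasDerivAt_pow 3 ρ).const_mul (4 * k))).add
      ((hasDerivAt_pow 2 ρ).const_mul (6 * k))).add
      ((hasDerivAt_id ρ).const_mul (4 * k))).add_const k).congr_deriv ?_
    norm_num
  have hs : HasDerivAt (fun x : ℝ => (x + 1) ^ 2) (2 * (ρ + 1)) ρ :=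
    (((hasDerivAt_id ρ).add_const 1).pow 2).congr_deriv (by norm_num)
  have hb := ((((hasDerivAt_pow 2 ρ).const_mul ((S.m₁ + S.m₂) * a ^ 2)).mul hs).mul hp).sub
    (hq.const_mul b)
  refine (hb.div (hasDerivAt_pow 4 ρ) (by positivity)).congr_deriv ?_
  have : 1 + ρ ≠ 0 := by positivity
  unfold slope p₁ q₁
  simp only [Pi.mul_apply, Pi.sub_apply]
  field_simp
  push_cast
  ring

theorem slope_strictMonoOn : StrictMonoOn S.slope (Set.Ici 0) := by
  have hν := S.ν_pos
  have hν1 := S.ν_lt_one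
  have hd : ∀ ρ : ℝ, 0 ≤ ρ → HasDerivAt S.slope
      (5 * ρ ^ 4 + 30 * ρ ^ 5 + (1 - S.ν) * (4 * ρ - 6 * ρ ^ 2)
        + S.ν * (20 * ρ ^ 4 - 10 * ρ ^ 4 / (1 + ρ) ^ 2 + 4 * ρ ^ 5 / (1 + ρ) ^ 3)) ρ := by
    intro ρ hρ
    have hs0 : 1 + ρ ≠ 0 := by positivity
    have hs : HasDerivAt (fun x : ℝ => (1 + x) ^ 2) (2 * (1 + ρ)) ρ :=
      (((hasDerivAt_id ρ).const_add 1).pow 2).congr_deriv (by norm_num)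
    have h1 := (((((hasDerivAt_id ρ).const_mul 5).const_add 1).add_const (4 * S.ν)).sub
      ((hasDerivAt_const ρ (2 * S.ν)).div hs (by positivity)))
    have h2 := (((hasDerivAt_pow 2 ρ).const_mul 2).sub ((hasDerivAt_pow 3 ρ).const_mul 2)).const_mul
      (1 - S.ν)
    refine (((hasDerivAt_pow 5 ρ).mul h1).add h2).congr_deriv ?_
    simp only [Pi.sub_apply, Pi.div_apply, id]
    field_simp
    push_cast
    ring
  refine strictMonoOn_of_deriv_pos (convex_Ici 0)
    (fun ρ hρ => (hd ρ hρ).continuousAt.continuousWithinAt) ?_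
  intro ρ hρ
  rw [interior_Ici, Set.mem_Ioi] at hρ
  rw [(hd ρ hρ.le).deriv]
  have e1 : ρ ^ 4 / (1 + ρ) ^ 2 ≤ ρ ^ 4 := by
    apply div_le_self (by positivity)
    exact one_le_pow₀ (by linarith)
  have e2 : 0 < S.ν * (20 * ρ ^ 4 - 10 * ρ ^ 4 / (1 + ρ) ^ 2 + 4 * ρ ^ 5 / (1 + ρ) ^ 3) := by
    apply mul_pos hν
    have : 0 < 4 * ρ ^ 5 / (1 + ρ) ^ 3 := by positivity
    have : 0 < ρ ^ 4 := by positivity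
    have : 10 * ρ ^ 4 / (1 + ρ) ^ 2 = 10 * (ρ ^ 4 / (1 + ρ) ^ 2) := by ring
    linarith
  have e3 : 0 < 5 * ρ ^ 4 + 30 * ρ ^ 5 + (1 - S.ν) * (4 * ρ - 6 * ρ ^ 2) := by
    rcases le_total ρ (2 / 3) with h | h
    · have : 0 ≤ 4 * ρ - 6 * ρ ^ 2 := by nlinarith
      have : 0 ≤ (1 - S.ν) * (4 * ρ - 6 * ρ ^ 2) := mul_nonneg (by linarith) this
      positivity
    · -- beyond `2 / 3` the term `30 * ρ ^ 5` outweighs the only negative one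
      have h3 : (2 / 3 : ℝ) ^ 3 ≤ ρ ^ 3 := by gcongr
      have h4 : (2 / 3 : ℝ) ^ 3 * ρ ^ 2 ≤ ρ ^ 3 * ρ ^ 2 := by gcongr
      have h5 : -(6 * ρ ^ 2 - 4 * ρ) ≤ (1 - S.ν) * (4 * ρ - 6 * ρ ^ 2) := by nlinarith
      have : 0 < ρ ^ 4 := by positivity
      nlinarith
  linarith

theorem slope_zero : S.slope 0 = 0 := by simp [slope]

theorem slope_pos {ρ : ℝ} (hρ : 0 < ρ) : 0 < S.slope ρ := by
  have := S.slope_strictMonoOn (Set.mem_Ici.mpr le_rfl) (Set.mem_Ici.mpr hρ.le) hρ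
  rwa [slope_zero] at this

theorem continuousOn_slope : ContinuousOn S.slope (Set.Ici 0) := by
  unfold slope
  refine ContinuousOn.add (ContinuousOn.mul (by fun_prop) (ContinuousOn.sub (by fun_prop)
    (ContinuousOn.div (by fun_prop) (by fun_prop) ?_))) (by fun_prop)
  intro x hx
  have : (0 : ℝ) ≤ x := hx
  positivity

theorem exists_slope_eq {y : ℝ} (hy : 0 < y) : ∃ ρ, 0 < ρ ∧ S.slope ρ = y := by
  have hν := S.ν_pos
  have hν1 := S.ν_lt_one
  have hX : y ≤ S.slope (1 + y) := by
    have h1 : S.ν * (1 / (1 + (1 + y)) ^ 2) ≤ S.ν * 1 := by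
      gcongr
      rw [div_le_one (by positivity)]
      exact one_le_pow₀ (by linarith)
    have h3 : (1 + y) ^ 3 ≤ (1 + y) ^ 5 := pow_le_pow_right₀ (by linarith) (by norm_num)
    have h4 : 1 + y ≤ (1 + y) ^ 5 := le_self_pow₀ (by linarith) (by norm_num)
    have h5 : (1 + y) ^ 5 * (1 + 5 * (1 + y)) ≤
        (1 + y) ^ 5 * (1 + 5 * (1 + y) + 4 * S.ν - 2 * S.ν / (1 + (1 + y)) ^ 2) := by
      gcongr
      have : 2 * S.ν / (1 + (1 + y)) ^ 2 = 2 * (S.ν * (1 / (1 + (1 + y)) ^ 2)) := by ring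
      linarith
    have h6 : -(2 * (1 + y) ^ 3 - 2 * (1 + y) ^ 2) ≤
        (1 - S.ν) * (2 * (1 + y) ^ 2 - 2 * (1 + y) ^ 3) := by
      have : (1 + y) ^ 2 ≤ (1 + y) ^ 3 := pow_le_pow_right₀ (by linarith) (by norm_num)
      nlinarith
    have h7 : 0 ≤ (1 + y) ^ 2 := by positivity
    have h8 : 0 ≤ (1 + y) ^ 5 * y := by positivity
    unfold slope
    nlinarith
  obtain ⟨r, hr, hry⟩ := intermediate_value_Icc (show (0 : ℝ) ≤ 1 + y by linarith)
    (S.continuousOn_slope.mono Set.Icc_subset_Ici_self)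
    ⟨by rw [slope_zero]; exact hy.le, hX⟩
  refine ⟨r, lt_of_le_of_ne hr.1 ?_, hry⟩
  rintro rfl
  rw [slope_zero] at hry
  exact hy.ne hry

theorem exists_balance_pos {a : ℝ} (ha : 0 < a) (k b : ℝ) :
    ∃ X, 0 < X ∧ ∀ ρ, X ≤ ρ → 0 < S.balance a k b ρ := by
  have hν := S.ν_pos
  have hν1 := S.ν_lt_one
  have hm : 0 < S.m₁ + S.m₂ := add_pos S.m₁_pos S.m₂_pos
  have hc : 0 < (S.m₁ + S.m₂) * a ^ 2 := by positivity
  set c := (S.m₁ + S.m₂) * a ^ 2 with hcdef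
  have hb : 0 ≤ |b| * (1 + 16 * |k|) := by positivity
  refine ⟨2 + |b| * (1 + 16 * |k|) / c, by positivity, fun ρ hρ => ?_⟩
  have hρ2 : 2 ≤ ρ := by
    have : 0 ≤ |b| * (1 + 16 * |k|) / c := by positivity
    linarith
  have hbc : |b| * (1 + 16 * |k|) < c * ρ := by
    have : |b| * (1 + 16 * |k|) / c < ρ := by linarith
    rwa [div_lt_iff₀' hc] at this
  have hp : ρ ≤ S.p₁ ρ := by
    have h2 : 4 ≤ ρ ^ 2 := by nlinarith
    have h3 : 2 * ρ ^ 2 ≤ ρ ^ 3 := by nlinarith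
    have h5 : 0 ≤ ρ ^ 5 := by positivity
    have h4 : 0 ≤ S.ν * ρ ^ 4 := by positivity
    have h4' : 2 * ρ ^ 3 ≤ ρ ^ 4 := by nlinarith [sq_nonneg ρ]
    have h6 : (1 - S.ν) * (ρ ^ 2 + 2 * ρ + 1) ≤ 1 * (ρ ^ 2 + 2 * ρ + 1) := by
      gcongr; linarith
    have h7 : 0 ≤ S.ν * ρ ^ 3 := by positivity
    unfold p₁
    nlinarith
  have hs : (1 + ρ) ^ 4 ≤ 16 * ρ ^ 4 := by
    have : (1 + ρ) ^ 4 ≤ (2 * ρ) ^ 4 := by gcongr; linarith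
    linarith [mul_pow 2 ρ 4]
  have hq : b * q₁ k ρ ≤ |b| * (1 + 16 * |k|) * ρ ^ 4 := by
    calc b * q₁ k ρ ≤ |b * q₁ k ρ| := le_abs_self _
      _ = |b| * |ρ ^ 4 + k * (1 + ρ) ^ 4| := by rw [abs_mul, q₁_eq]
      _ ≤ |b| * (|ρ ^ 4| + |k * (1 + ρ) ^ 4|) := by gcongr; exact abs_add_le _ _
      _ = |b| * (ρ ^ 4 + |k| * (1 + ρ) ^ 4) := by
        rw [abs_mul, abs_of_nonneg (show 0 ≤ ρ ^ 4 by positivity),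
          abs_of_nonneg (show 0 ≤ (1 + ρ) ^ 4 by positivity)]
      _ ≤ |b| * (ρ ^ 4 + |k| * (16 * ρ ^ 4)) := by gcongr
      _ = |b| * (1 + 16 * |k|) * ρ ^ 4 := by ring
  have hlead : c * ρ * ρ ^ 4 ≤ c * ρ ^ 2 * (ρ + 1) ^ 2 * S.p₁ ρ := by
    calc c * ρ * ρ ^ 4 = c * ρ ^ 2 * ρ ^ 2 * ρ := by ring
      _ ≤ c * ρ ^ 2 * (ρ + 1) ^ 2 * S.p₁ ρ := by gcongr; linarith
  have hρ4 : 0 < ρ ^ 4 := by positivity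
  have := mul_lt_mul_of_pos_right hbc hρ4
  unfold balance
  rw [← hcdef]
  linarith

/-- The set of positive zeros of `balance`. -/
def balanceZeros (a k b : ℝ) : Set ℝ := {ρ | 0 < ρ ∧ S.balance a k b ρ = 0}

theorem strictMonoOn_balance_div {a k b r : ℝ}
    (h : ∀ x, r < x → 0 < (S.m₁ + S.m₂) * a ^ 2 * S.slope x + 4 * (b * k)) :
    StrictMonoOn (fun x => S.balance a k b x / x ^ 4) (Set.Ici r ∩ Set.Ioi 0) := by
  have hx0 : ∀ x ∈ Set.Ici r ∩ Set.Ioi (0 : ℝ), 0 < x := fun x hx => hx.2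
  refine strictMonoOn_of_deriv_pos ((convex_Ici r).inter (convex_Ioi 0))
    (fun x hx => (S.hasDerivAt_balance_div a k b (hx0 x hx)).continuousAt.continuousWithinAt) ?_
  intro x hx
  rw [interior_inter, interior_Ici, interior_Ioi] at hx
  have hx' : 0 < x := hx.2
  rw [(S.hasDerivAt_balance_div a k b hx').deriv]
  exact mul_pos (by positivity) (h x hx.1)

theorem strictAntiOn_balance_div {a k b r : ℝ}
    (h : ∀ x, 0 < x → x < r → (S.m₁ + S.m₂) * a ^ 2 * S.slope x + 4 * (b * k) < 0) :
    StrictAntiOn (fun x => S.balance a k b x / x ^ 4) (Set.Ioc 0 r) := by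
  refine strictAntiOn_of_deriv_neg (convex_Ioc 0 r)
    (fun x hx => (S.hasDerivAt_balance_div a k b hx.1).continuousAt.continuousWithinAt) ?_
  intro x hx
  rw [interior_Ioc] at hx
  rw [(S.hasDerivAt_balance_div a k b hx.1).deriv]
  have hx' : 0 < x := hx.1
  exact mul_neg_of_pos_of_neg (by positivity) (h x hx.1 hx.2)

/-- Around a zero `r` of the derivative, `balance a k b ρ / ρ ^ 4` decreases and then increases. -/
theorem balance_div_anti_mono {a k b r : ℝ} (ha : 0 < a) (hr : 0 < r)
    (h : (S.m₁ + S.m₂) * a ^ 2 * S.slope r + 4 * (b * k) = 0) :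
    StrictAntiOn (fun x => S.balance a k b x / x ^ 4) (Set.Ioc 0 r) ∧
      StrictMonoOn (fun x => S.balance a k b x / x ^ 4) (Set.Ici r) := by
  have hm : 0 < S.m₁ + S.m₂ := add_pos S.m₁_pos S.m₂_pos
  have hc : 0 < (S.m₁ + S.m₂) * a ^ 2 := by positivity
  constructor
  · refine S.strictAntiOn_balance_div fun x hx hxr => ?_
    have := mul_lt_mul_of_pos_left
      (S.slope_strictMonoOn (Set.mem_Ici.mpr hx.le) (Set.mem_Ici.mpr hr.le) hxr) hc
    linarith
  · refine (S.strictMonoOn_balance_div (a := a) (b := b) (k := k) fun x hx => ?_).mono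
      fun x hx => ⟨hx, hr.trans_le hx⟩
    have := mul_lt_mul_of_pos_left
      (S.slope_strictMonoOn (Set.mem_Ici.mpr hr.le) (Set.mem_Ici.mpr (hr.trans hx).le) hx) hc
    linarith

/-- For `b * k > 0` the function `balance a k b ρ / ρ ^ 4` increases from `-∞` to `∞`. -/
theorem encard_balanceZeros_of_mul_pos {a k b : ℝ} (ha : 0 < a) (hbk : 0 < b * k) :
    (S.balanceZeros a k b).encard = 1 := by
  have hm : 0 < S.m₁ + S.m₂ := add_pos S.m₁_pos S.m₂_pos
  have hmono := S.strictMonoOn_balance_div (a := a) (k := k) (b := b) (r := 0) fun x hx => by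
    have := S.slope_pos hx
    positivity
  obtain ⟨X, hX, hpos⟩ := S.exists_balance_pos ha k b
  obtain ⟨r, hr, hr0⟩ := intermediate_value_Icc hX.le (S.continuous_balance a k b).continuousOn
    ⟨by rw [balance_zero]; linarith, (hpos X le_rfl).le⟩
  have hrpos : 0 < r := by
    refine lt_of_le_of_ne hr.1 ?_
    rintro rfl
    rw [balance_zero] at hr0
    linarith
  rw [Set.encard_eq_one]
  refine ⟨r, Set.Subset.antisymm (fun x hx => ?_) ?_⟩
  · refine hmono.injOn ⟨hx.1.le, hx.1⟩ ⟨hrpos.le, hrpos⟩ ?_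
    simp [hx.2, hr0]
  · rintro _ rfl
    exact ⟨hrpos, hr0⟩

/-- For `b * k < 0` the function `balance a k b ρ / ρ ^ 4` tends to `∞` at both ends of `(0, ∞)`, and
decreases before it increases. -/
theorem encard_balanceZeros_eq_two {a k b x : ℝ} (ha : 0 < a) (hbk : b * k < 0) (hx : 0 < x)
    (hneg : S.balance a k b x < 0) : (S.balanceZeros a k b).encard = 2 := by
  have hm : 0 < S.m₁ + S.m₂ := add_pos S.m₁_pos S.m₂_pos
  have hc : 0 < (S.m₁ + S.m₂) * a ^ 2 := by positivity
  obtain ⟨r, hr, hrs⟩ := S.exists_slope_eq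
    (show 0 < -(4 * (b * k)) / ((S.m₁ + S.m₂) * a ^ 2) by apply div_pos <;> linarith)
  obtain ⟨hanti, hmono⟩ := S.balance_div_anti_mono (k := k) (b := b) ha hr (by
    rw [hrs]; field_simp; ring)
  obtain ⟨X, hX, hpos⟩ := S.exists_balance_pos ha k b
  have hxX : x ≤ X := by
    by_contra hcon
    exact absurd (hpos x (not_le.mp hcon).le) (not_lt.mpr hneg.le)
  obtain ⟨u, hu, hu0⟩ := intermediate_value_Icc' hx.le (S.continuous_balance a k b).continuousOn
    ⟨hneg.le, by rw [balance_zero]; linarith⟩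
  obtain ⟨v, hv, hv0⟩ := intermediate_value_Icc hxX (S.continuous_balance a k b).continuousOn
    ⟨hneg.le, (hpos X le_rfl).le⟩
  have hupos : 0 < u := by
    refine lt_of_le_of_ne hu.1 ?_
    rintro rfl
    rw [balance_zero] at hu0
    linarith
  have hux : u < x := lt_of_le_of_ne hu.2 (by rintro rfl; exact hneg.ne hu0)
  have hxv : x < v := lt_of_le_of_ne hv.1 (by rintro rfl; exact hneg.ne hv0)
  have hFx : S.balance a k b x / x ^ 4 < 0 := div_neg_of_neg_of_pos hneg (by positivity)
  have hur : u ≤ r := by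
    by_contra hcon
    have := hmono (not_le.mp hcon).le ((not_le.mp hcon).trans hux).le hux
    simp only [hu0, zero_div] at this
    linarith
  have hrv : r ≤ v := by
    by_contra hcon
    have := hanti ⟨hx, (hxv.trans (not_le.mp hcon)).le⟩ ⟨hx.trans hxv, (not_le.mp hcon).le⟩ hxv
    simp only [hv0, zero_div] at this
    linarith
  rw [Set.encard_eq_two]
  refine ⟨u, v, (hux.trans hxv).ne, Set.Subset.antisymm (fun y hy => ?_) ?_⟩
  · rcases le_total y r with h | h
    · left
      refine hanti.injOn ⟨hy.1, h⟩ ⟨hupos, hur⟩ ?_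
      simp [hy.2, hu0]
    · right
      refine hmono.injOn h hrv ?_
      simp [hy.2, hv0]
  · rintro y (rfl | rfl)
    · exact ⟨hupos, hu0⟩
    · exact ⟨hx.trans hxv, hv0⟩

/-- A local extremum of `R₁` off its poles, with value `b`, is a zero of the derivative of
`balance a k b ρ / ρ ^ 4`, hence its strict global minimum point. -/
theorem balance_pos_of_isLocalExtr {a k r : ℝ} (ha : 0 < a) (hr : 0 < r) (hq : q₁ k r ≠ 0)
    (h : IsLocalExtr (S.R₁ a k) r) :
    S.R₁ a k r * k < 0 ∧ ∀ x, 0 < x → x ≠ r → 0 < S.balance a k (S.R₁ a k r) x := by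
  have hm : 0 < S.m₁ + S.m₂ := add_pos S.m₁_pos S.m₂_pos
  set b := S.R₁ a k r with hb
  have hne : ∀ᶠ x in 𝓝 r, 0 < q₁ k x / q₁ k r := by
    have hc : ContinuousAt (fun x => q₁ k x / q₁ k r) r :=
      (continuous_q₁ k).continuousAt.div_const _
    refine hc.eventually (lt_mem_nhds ?_)
    simp only [div_self hq, zero_lt_one]
  have h0 : S.balance a k b r = 0 := by rw [S.balance_eq hq, ← hb]; ring
  -- near `r`, the quotient is `q₁ k r * (R₁ - b)` up to a positive factor
  have hfac : ∀ᶠ x in 𝓝 r, ∃ t, 0 < t ∧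
      S.balance a k b x / x ^ 4 = t * (q₁ k r * (S.R₁ a k x - b)) := by
    filter_upwards [hne, lt_mem_nhds hr] with x hx hx0
    have hqx : q₁ k x ≠ 0 := by
      intro h; rw [h, zero_div] at hx; exact lt_irrefl _ hx
    refine ⟨q₁ k x / q₁ k r / x ^ 4, by positivity, ?_⟩
    rw [S.balance_eq hqx]
    field_simp
  have hextr : IsLocalExtr (fun x => S.balance a k b x / x ^ 4) r := by
    have hsign : (∀ᶠ x in 𝓝 r, 0 ≤ q₁ k r * (S.R₁ a k x - b)) ∨
        (∀ᶠ x in 𝓝 r, q₁ k r * (S.R₁ a k x - b) ≤ 0) := by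
      rcases hq.lt_or_gt with hq' | hq' <;> rcases h with h | h
      · right
        filter_upwards [h] with x hx
        exact mul_nonpos_of_nonpos_of_nonneg hq'.le (by linarith)
      · left
        filter_upwards [h] with x hx
        exact mul_nonneg_of_nonpos_of_nonpos hq'.le (by linarith)
      · left
        filter_upwards [h] with x hx
        exact mul_nonneg hq'.le (by linarith)
      · right
        filter_upwards [h] with x hx
        exact mul_nonpos_of_nonneg_of_nonpos hq'.le (by linarith)
    rcases hsign with hs | hs
    · left
      filter_upwards [hfac, hs] with x ⟨t, ht, hxt⟩ hx
      rw [h0, hxt, zero_div]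
      exact mul_nonneg ht.le hx
    · right
      filter_upwards [hfac, hs] with x ⟨t, ht, hxt⟩ hx
      rw [h0, hxt, zero_div]
      exact mul_nonpos_of_nonneg_of_nonpos ht.le hx
  have hd := hextr.hasDerivAt_eq_zero (S.hasDerivAt_balance_div a k b hr)
  have hd' : (S.m₁ + S.m₂) * a ^ 2 * S.slope r + 4 * (b * k) = 0 := by
    rcases mul_eq_zero.mp hd with h | h
    · have : 0 < (1 + r) ^ 3 / r ^ 5 := by positivity
      exact absurd h this.ne'
    · exact h
  have hsl := S.slope_pos hr
  have hpos : 0 < (S.m₁ + S.m₂) * a ^ 2 * S.slope r := by positivity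
  refine ⟨by linarith, fun x hx hxr => ?_⟩
  obtain ⟨hanti, hmono⟩ := S.balance_div_anti_mono ha hr hd'
  have hF : S.balance a k b r / r ^ 4 < S.balance a k b x / x ^ 4 := by
    rcases hxr.lt_or_gt with hlt | hlt
    · exact hanti ⟨hx, hlt.le⟩ ⟨hr, le_rfl⟩ hlt
    · exact hmono (Set.mem_Ici.mpr le_rfl) hlt.le hlt
  rw [h0, zero_div] at hF
  by_contra hcon
  exact absurd (div_nonpos_of_nonpos_of_nonneg (not_lt.mp hcon) (by positivity)) (not_le.mpr hF)

end GyrostatSystem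

/-! ### The gradient of the potential -/

theorem hasFDerivAt_norm {r : E3} (hr : r ≠ 0) :
    HasFDerivAt (fun x : E3 => ‖x‖) (‖r‖⁻¹ • innerSL ℝ r) r := by
  have hr' : ‖r‖ ≠ 0 := norm_ne_zero_iff.mpr hr
  have h := ((hasFDerivAt_id r).norm_sq).sqrt (by simpa using hr)
  simp only [id, Real.sqrt_sq (norm_nonneg _)] at h
  refine h.congr_fderiv ?_
  ext v
  simp
  field_simp

theorem hasGradientAt_div_norm_pow (c : ℝ) (n : ℕ) {r : E3} (hr : r ≠ 0) :
    HasGradientAt (fun x : E3 => c / ‖x‖ ^ n) ((-(n * c) / ‖r‖ ^ (n + 2)) • r) r := by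
  have hr' : ‖r‖ ≠ 0 := norm_ne_zero_iff.mpr hr
  have h1 : HasDerivAt (fun t : ℝ => c / t ^ n) (-(n * c) / ‖r‖ ^ (n + 1)) ‖r‖ := by
    refine ((hasDerivAt_const _ c).div (hasDerivAt_pow n ‖r‖) (by positivity)).congr_deriv ?_
    rcases n with _ | n
    · simp
    · push_cast
      field_simp
      ring
  rw [hasGradientAt_iff_hasFDerivAt]
  refine (h1.comp_hasFDerivAt r (hasFDerivAt_norm hr)).congr_fderiv ?_
  ext v
  simp
  field_simp
  ring

theorem inner_diagAct (A C : ℝ) (x y : E3) :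
    inner ℝ x (diagAct A C y) = A * (x 0 * y 0) + A * (x 1 * y 1) + C * (x 2 * y 2) := by
  simp [diagAct, PiLp.inner_apply, Fin.sum_univ_three]
  ring

theorem hasGradientAt_inner_diagAct (A C : ℝ) (r : E3) :
    HasGradientAt (fun x : E3 => inner ℝ x (diagAct A C x)) ((2 : ℝ) • diagAct A C r) r := by
  have h : ∀ i : Fin 3, HasFDerivAt (fun x : E3 => x i)
      (EuclideanSpace.proj i : E3 →L[ℝ] ℝ) r :=
    fun i => (EuclideanSpace.proj i : E3 →L[ℝ] ℝ).hasFDerivAt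
  simp only [inner_diagAct]
  rw [hasGradientAt_iff_hasFDerivAt]
  refine (((((h 0).mul (h 0)).const_mul A).add (((h 1).mul (h 1)).const_mul A)).add
    (((h 2).mul (h 2)).const_mul C)).congr_fderiv ?_
  ext v
  simp [real_inner_comm v, inner_diagAct]
  ring

/-- The form in which the chain rule is needed: both relative positions are affine in `λ` and in `μ`. -/
theorem HasGradientAt.comp_add_smul {U : E3 → ℝ} {g b x : E3} {c : ℝ}
    (h : HasGradientAt U g (b + c • x)) : HasGradientAt (fun y => U (b + c • y)) (c • g) x := by
  rw [hasGradientAt_iff_hasFDerivAt] at h ⊢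
  refine (h.comp x (((hasFDerivAt_id x).const_smul c).const_add b)).congr_fderiv ?_
  ext v
  simp

theorem HasGradientAt.add {f g : E3 → ℝ} {f' g' x : E3} (hf : HasGradientAt f f' x)
    (hg : HasGradientAt g g' x) : HasGradientAt (fun y => f y + g y) (f' + g') x := by
  rw [hasGradientAt_iff_hasFDerivAt] at *
  refine (hf.add hg).congr_fderiv ?_
  simp

/-- The potential energy of a point mass `m₀` at the position `r` relative to a body of mass `m` with
tensor of inertia `diag(A, A, C)`, to second order. -/
def bodyPotential (G m₀ m A C : ℝ) (r : E3) : ℝ :=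
  -(G * m * m₀) / ‖r‖ ^ 1 + -(1 / 2 * (G * m₀ * (2 * A + C))) / ‖r‖ ^ 3
    + (3 / 2 * (G * m₀)) / ‖r‖ ^ 5 * inner ℝ r (diagAct A C r)

/-- In the equatorial plane of the body the force is central. -/
theorem hasGradientAt_bodyPotential (G m₀ m A C : ℝ) {r : E3} (hr : r ≠ 0) (hr2 : r 2 = 0) :
    HasGradientAt (bodyPotential G m₀ m A C)
      ((G * m₀ * (m / ‖r‖ ^ 3 + 3 * (C - A) / 2 / ‖r‖ ^ 5)) • r) r := by
  have hr' : ‖r‖ ≠ 0 := norm_ne_zero_iff.mpr hr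
  have h1 := hasGradientAt_div_norm_pow (-(G * m * m₀)) 1 hr
  have h3 := hasGradientAt_div_norm_pow (-(1 / 2 * (G * m₀ * (2 * A + C)))) 3 hr
  have h5 := hasGradientAt_div_norm_pow (3 / 2 * (G * m₀)) 5 hr
  have hi := hasGradientAt_inner_diagAct A C r
  have hact : diagAct A C r = A • r := by
    ext i; fin_cases i <;> simp [diagAct, hr2]
  rw [hasGradientAt_iff_hasFDerivAt] at *
  refine ((h1.add h3).add (h5.mul hi)).congr_fderiv ?_
  ext v
  simp only [hact, inner_smul_right, real_inner_self_eq_norm_sq, map_smul, add_apply,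
    smul_apply, InnerProductSpace.toDual_apply_apply, smul_eq_mul]
  push_cast
  field_simp
  ring

namespace GyrostatSystem

variable (S : GyrostatSystem)

theorem M₂_pos : 0 < S.M₂ := add_pos S.m₁_pos S.m₂_pos

theorem g₁_pos : 0 < S.g₁ := div_pos (mul_pos S.m₁_pos S.m₂_pos) S.M₂_pos

theorem potential_eq (m₀ : ℝ) (lam mu : E3) :
    S.potential m₀ lam mu = -(S.G * S.m₁ * S.m₂) / ‖lam‖ ^ 1
      + bodyPotential S.G m₀ S.m₁ S.A₁ S.C₁ (S.r₀₁ lam mu)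
      + bodyPotential S.G m₀ S.m₂ S.A₂ S.C₂ (S.r₀₂ lam mu) := by
  unfold potential potential₁ potential₂ bodyPotential
  ring

/-- The attraction of `S₁` and `S₂` on `S₀`: on collinear configurations `∇_μ V = m₀ * pull * λ`. -/
def pull (a ρ : ℝ) : ℝ :=
  S.G * (S.m₁ / (ρ ^ 2 * a ^ 3) + S.β₁ / (ρ ^ 4 * a ^ 5)
    + S.m₂ / ((1 + ρ) ^ 2 * a ^ 3) + S.β₂ / ((1 + ρ) ^ 4 * a ^ 5))

variable {S}

theorem mu_eq {lam mu : E3} {ρ : ℝ} (h : S.r₀₁ lam mu = ρ • lam) : mu = (ρ + S.ν) • lam := by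
  rw [r₀₁, sub_eq_iff_eq_add] at h
  rw [h, ν, M₂, add_smul]

theorem r₀₂_eq {lam mu : E3} {ρ : ℝ} (h : S.r₀₁ lam mu = ρ • lam) :
    S.r₀₂ lam mu = (1 + ρ) • lam := by
  have := S.M₂_pos.ne'
  rw [r₀₂, mu_eq h, ← add_smul]
  congr 1
  unfold ν M₂ at *
  field_simp
  ring

/-- The gradient with respect to `λ` on collinear configurations perpendicular to the axes. -/
theorem gradLam_eq {lam mu : E3} {a ρ : ℝ} (m₀ : ℝ) (ha : 0 < a) (hρ : 0 < ρ) (hlam : ‖lam‖ = a)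
    (h2 : lam 2 = 0) (h : S.r₀₁ lam mu = ρ • lam) :
    S.gradLam m₀ lam mu = S.h₁ a m₀ ρ • lam := by
  have hl0 : lam ≠ 0 := by
    rw [← norm_ne_zero_iff, hlam]; exact ha.ne'
  have hM := S.M₂_pos.ne'
  have h02 := r₀₂_eq h
  have hd0 := hasGradientAt_div_norm_pow (-(S.G * S.m₁ * S.m₂)) 1 hl0
  have hd1 := hasGradientAt_bodyPotential S.G m₀ S.m₁ S.A₁ S.C₁ (r := S.r₀₁ lam mu)
    (by rw [h]; exact smul_ne_zero hρ.ne' hl0) (by rw [h]; simp [h2])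
  have hd2 := hasGradientAt_bodyPotential S.G m₀ S.m₂ S.A₂ S.C₂ (r := S.r₀₂ lam mu)
    (by rw [h02]; exact smul_ne_zero (by positivity) hl0) (by rw [h02]; simp [h2])
  have e1 : ∀ x, S.r₀₁ x mu = mu + (-(S.m₂ / S.M₂)) • x := fun x => by
    rw [r₀₁, neg_smul, sub_eq_add_neg]
  have e2 : ∀ x, S.r₀₂ x mu = mu + (S.m₁ / S.M₂) • x := fun x => rfl
  have n1 : ‖S.r₀₁ lam mu‖ = ρ * a := by
    rw [h, norm_smul, hlam, Real.norm_of_nonneg hρ.le]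
  have n2 : ‖S.r₀₂ lam mu‖ = (1 + ρ) * a := by
    rw [h02, norm_smul, hlam, Real.norm_of_nonneg (by positivity)]
  rw [n1, h] at hd1
  rw [n2, h02] at hd2
  rw [← h, e1 lam] at hd1
  rw [← h02, e2 lam] at hd2
  have hd := (hd0.add hd1.comp_add_smul).add hd2.comp_add_smul
  have hpot : (fun x => S.potential m₀ x mu) = fun x => -(S.G * S.m₁ * S.m₂) / ‖x‖ ^ 1
      + bodyPotential S.G m₀ S.m₁ S.A₁ S.C₁ (mu + (-(S.m₂ / S.M₂)) • x)
      + bodyPotential S.G m₀ S.m₂ S.A₂ S.C₂ (mu + (S.m₁ / S.M₂) • x) := by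
    funext x
    rw [potential_eq, e1, e2]
  rw [gradLam, hpot, hd.gradient, ← e1, ← e2, h, h02, hlam]
  simp only [smul_smul, ← add_smul]
  congr 1
  unfold h₁ β₁ β₂
  field_simp
  push_cast
  ring

/-- The gradient with respect to `μ` on collinear configurations perpendicular to the axes. -/
theorem gradMu_eq {lam mu : E3} {a ρ : ℝ} (m₀ : ℝ) (ha : 0 < a) (hρ : 0 < ρ) (hlam : ‖lam‖ = a)
    (h2 : lam 2 = 0) (h : S.r₀₁ lam mu = ρ • lam) :
    S.gradMu m₀ lam mu = (m₀ * S.pull a ρ) • lam := by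
  have hl0 : lam ≠ 0 := by
    rw [← norm_ne_zero_iff, hlam]; exact ha.ne'
  have h02 := r₀₂_eq h
  have hd1 := hasGradientAt_bodyPotential S.G m₀ S.m₁ S.A₁ S.C₁ (r := S.r₀₁ lam mu)
    (by rw [h]; exact smul_ne_zero hρ.ne' hl0) (by rw [h]; simp [h2])
  have hd2 := hasGradientAt_bodyPotential S.G m₀ S.m₂ S.A₂ S.C₂ (r := S.r₀₂ lam mu)
    (by rw [h02]; exact smul_ne_zero (by positivity) hl0) (by rw [h02]; simp [h2])
  have e1 : ∀ x, S.r₀₁ lam x = -((S.m₂ / S.M₂) • lam) + (1 : ℝ) • x := fun x => by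
    rw [r₀₁, one_smul, sub_eq_neg_add]
  have e2 : ∀ x, S.r₀₂ lam x = (S.m₁ / S.M₂) • lam + (1 : ℝ) • x := fun x => by
    rw [r₀₂, one_smul, add_comm]
  have n1 : ‖S.r₀₁ lam mu‖ = ρ * a := by
    rw [h, norm_smul, hlam, Real.norm_of_nonneg hρ.le]
  have n2 : ‖S.r₀₂ lam mu‖ = (1 + ρ) * a := by
    rw [h02, norm_smul, hlam, Real.norm_of_nonneg (by positivity)]
  rw [n1, h] at hd1
  rw [n2, h02] at hd2
  rw [← h, e1 mu] at hd1
  rw [← h02, e2 mu] at hd2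
  have hd := hd1.comp_add_smul.add hd2.comp_add_smul
  have hpot : (fun x => S.potential m₀ lam x) = fun x =>
      (bodyPotential S.G m₀ S.m₁ S.A₁ S.C₁ (-((S.m₂ / S.M₂) • lam) + (1 : ℝ) • x)
      + bodyPotential S.G m₀ S.m₂ S.A₂ S.C₂ ((S.m₁ / S.M₂) • lam + (1 : ℝ) • x))
      + -(S.G * S.m₁ * S.m₂) / ‖lam‖ ^ 1 := by
    funext x
    rw [potential_eq, e1, e2]
    ring
  have hconst : HasGradientAt (fun _ : E3 => -(S.G * S.m₁ * S.m₂) / ‖lam‖ ^ 1) 0 mu :=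
    hasGradientAt_const _ _
  rw [gradMu, hpot, (hd.add hconst).gradient, ← e1, ← e2, h, h02]
  simp only [smul_smul, ← add_smul, add_zero]
  congr 1
  unfold pull β₁ β₂
  field_simp
  ring

end GyrostatSystem

/-! ### Relative equilibria to first order in the mass of the gyrostat -/

theorem norm_cross_sq (u v : E3) : ‖cross u v‖ ^ 2 = ‖u‖ ^ 2 * ‖v‖ ^ 2 - inner ℝ u v ^ 2 := by
  simp [EuclideanSpace.real_norm_sq_eq, PiLp.inner_apply, Fin.sum_univ_three, cross, cross_apply]
  ring

theorem norm_cross_le (u v : E3) : ‖cross u v‖ ≤ ‖u‖ * ‖v‖ := by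
  refine abs_le_of_sq_le_sq' ?_ (by positivity) |>.2
  rw [norm_cross_sq, mul_pow]
  nlinarith [sq_nonneg (inner ℝ u v)]

theorem inner_cross_cross (u v : E3) :
    inner ℝ (cross (cross u v) v) u = inner ℝ u v ^ 2 - ‖u‖ ^ 2 * ‖v‖ ^ 2 := by
  simp [EuclideanSpace.real_norm_sq_eq, PiLp.inner_apply, Fin.sum_univ_three, cross, cross_apply]
  ring

theorem cross_smul_left (c : ℝ) (u v : E3) : cross (c • u) v = c • cross u v := by
  ext i; fin_cases i <;> simp [cross, cross_apply]

theorem cross_sub_left (u v w : E3) : cross (u - v) w = cross u w - cross v w := by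
  ext i; fin_cases i <;> simp [cross, cross_apply]

/-- The balance of centrifugal and attractive forces for an oscillator of reduced mass `g` at `c • λ`
in a frame rotating with `Ω ⊥ λ`: the residues of the two equations of motion control the defect of
`g c |Ω|² = h`. -/
theorem abs_centrifugal_sub_le {lam p Ω : E3} {g c h : ℝ} (hg : 0 < g)
    (hΩ : inner ℝ Ω lam = 0) :
    |g * c * (‖lam‖ ^ 2 * ‖Ω‖ ^ 2) - h * ‖lam‖ ^ 2| ≤
      ‖cross p Ω - h • lam‖ * ‖lam‖
        + g * (‖g⁻¹ • p + cross (c • lam) Ω‖ * ‖Ω‖ * ‖lam‖) := by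
  set e := g⁻¹ • p + cross (c • lam) Ω with he
  set e' := cross p Ω - h • lam with he'
  have hp : p = g • (e - c • cross lam Ω) := by
    rw [he, cross_smul_left, add_sub_cancel_right, smul_inv_smul₀ hg.ne']
  have hid : g * c * (‖lam‖ ^ 2 * ‖Ω‖ ^ 2) - h * ‖lam‖ ^ 2
      = inner ℝ e' lam - g * inner ℝ (cross e Ω) lam := by
    have : cross p Ω = g • (cross e Ω - c • cross (cross lam Ω) Ω) := by
      conv_lhs => rw [hp]
      rw [cross_smul_left, cross_sub_left, cross_smul_left]
    rw [he', this, inner_sub_left, inner_smul_left, inner_sub_left, inner_smul_left,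
      inner_smul_left, inner_cross_cross, real_inner_comm Ω lam, hΩ, real_inner_self_eq_norm_sq]
    simp
    ring
  rw [hid]
  refine (abs_sub _ _).trans (add_le_add (abs_real_inner_le_norm _ _) ?_)
  rw [abs_mul, abs_of_pos hg]
  gcongr
  refine (abs_real_inner_le_norm _ _).trans ?_
  gcongr
  exact norm_cross_le _ _

/-- The error may grow with `t`, so the boundedness of `t` is part of what is shown: a linear error cannot
compensate a quadratic growth. -/
theorem tendsto_sq_of_abs_sub_le {l : Filter ℝ} {t h ε : ℝ → ℝ} {A H : ℝ} (hA : 0 < A)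
    (ht : ∀ᶠ x in l, 0 ≤ t x) (hh : Tendsto h l (𝓝 H)) (hε : Tendsto ε l (𝓝 0))
    (hb : ∀ᶠ x in l, |A * t x ^ 2 - h x| ≤ ε x * (1 + t x)) :
    Tendsto (fun x => t x ^ 2) l (𝓝 (H / A)) := by
  have hε0 : ∀ᶠ x in l, 0 ≤ ε x := by
    filter_upwards [hb, ht] with x hx htx
    have := (abs_nonneg _).trans hx
    exact nonneg_of_mul_nonneg_left this (by linarith)
  have hbd : ∀ᶠ x in l, t x ^ 2 ≤ 2 * (|H| + 1 + A) / A := by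
    filter_upwards [hb, ht, hε0, hε.eventually (gt_mem_nhds (show 0 < A / 2 by positivity)),
      hh.eventually (gt_mem_nhds (show H < |H| + 1 by linarith [le_abs_self H]))]
      with x h1 h2 h3 h4 h5
    have h6 := (le_abs_self _).trans h1
    have h7 : 1 + t x ≤ 2 + t x ^ 2 := by nlinarith [sq_nonneg (t x - 1)]
    have h8 : ε x * (1 + t x) ≤ ε x * (2 + t x ^ 2) := by gcongr
    have h9 : ε x * (2 + t x ^ 2) ≤ A / 2 * (2 + t x ^ 2) := by gcongr
    rw [le_div_iff₀ hA]
    linarith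
  have hlim : Tendsto (fun x => A * t x ^ 2 - h x) l (𝓝 0) := by
    have : Tendsto (fun x => ε x * (2 + 2 * (|H| + 1 + A) / A)) l (𝓝 0) := by
      simpa using hε.mul_const (2 + 2 * (|H| + 1 + A) / A)
    refine squeeze_zero_norm' ?_ this
    filter_upwards [hb, ht, hε0, hbd] with x h1 h2 h3 h4
    refine h1.trans (mul_le_mul_of_nonneg_left ?_ h3)
    nlinarith [sq_nonneg (t x - 1)]
  have := (hlim.add hh).div_const A
  simp only [zero_add] at this
  refine this.congr fun x => ?_
  field_simp
  ring

namespace GyrostatSystem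

variable {S : GyrostatSystem}

theorem tendsto_h₁ (a ρ : ℝ) :
    Tendsto (fun m₀ => S.h₁ a m₀ ρ) (𝓝[>] 0) (𝓝 (S.G * S.m₁ * S.m₂ / a ^ 3)) := by
  have hc : Continuous fun m₀ => S.h₁ a m₀ ρ := by unfold h₁; fun_prop
  have := hc.tendsto 0
  simp only [h₁, mul_zero, zero_mul, zero_div, add_zero, sub_zero] at this
  exact this.mono_left nhdsWithin_le_nhds

theorem tendsto_mass_ratio :
    Tendsto (fun m₀ => S.M₂ / S.M₁ m₀) (𝓝[>] 0) (𝓝 1) := by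
  have hM := S.M₂_pos
  have h0 : S.M₁ 0 = S.M₂ := by simp [M₁, M₂]
  have hc : ContinuousAt (fun m₀ => S.M₂ / S.M₁ m₀) 0 := by
    have h1 : Continuous S.M₁ := by unfold M₁; fun_prop
    exact continuousAt_const.div h1.continuousAt (by rw [h0]; exact hM.ne')
  have := hc.tendsto
  simp only [h0, div_self hM.ne'] at this
  exact this.mono_left nhdsWithin_le_nhds

theorem g₂_eq (m₀ : ℝ) : S.g₂ m₀ = m₀ * (S.M₂ / S.M₁ m₀) := by
  rw [g₂, mul_div_assoc]

theorem g₂_pos {m₀ : ℝ} (h : 0 < m₀) : 0 < S.g₂ m₀ := by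
  have := S.M₂_pos
  have : 0 < S.M₁ m₀ := add_pos S.M₂_pos h
  unfold g₂; positivity

theorem limit_sq_eq {a : ℝ} (ha : 0 < a) :
    S.G * S.m₁ * S.m₂ / a ^ 3 * a ^ 2 / (S.g₁ * a ^ 2) = S.G * S.M₂ / a ^ 3 := by
  have := S.m₁_pos
  have := S.m₂_pos
  have := S.M₂_pos
  unfold g₁
  field_simp

/-- The equations for `λ` and `p_λ` force `|Ω₀|²` to tend to `G M₂ / a³`, the value in the two-body
problem of `S₁` and `S₂`; the equations for `μ` and `p_μ`, divided by `m₀`, then become this balance of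
forces on `S₀` in the limit. -/
theorem pull_eq_of_isFirstOrderEulerian {a ρ : ℝ} {z : ℝ → State} (ha : 0 < a)
    (hz : S.IsFirstOrderEulerian a ρ z) :
    (ρ + S.ν) * (S.G * S.M₂ / a ^ 3) = S.pull a ρ := by
  obtain ⟨hE, -, -, -, hlam, hpLam, hmu, hpMu⟩ := hz
  have hg₁ := S.g₁_pos
  have hE' : ∀ᶠ m₀ in 𝓝[>] (0 : ℝ), 0 < m₀ ∧ S.IsEulerS₂S₁S₀ a ρ (z m₀) :=
    (eventually_mem_nhdsWithin).and hE
  have hlim0 : Tendsto (fun m₀ : ℝ => m₀) (𝓝[>] 0) (𝓝 0) :=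
    tendsto_id.mono_left nhdsWithin_le_nhds
  have n1 := (hlam.trans_tendsto hlim0).norm
  have n2 := (hpLam.trans_tendsto hlim0).norm
  have n3 := (hmu.trans_tendsto hlim0).norm
  have n4 : Tendsto (fun m₀ => ‖(S.field m₀ (z m₀)).pMu‖ / m₀) (𝓝[>] 0) (𝓝 0) :=
    hpMu.norm_left.tendsto_div_nhds_zero
  simp only [norm_zero] at n1 n2 n3
  have hsq : Tendsto (fun m₀ => ‖S.Ω₀ (z m₀)‖ ^ 2) (𝓝[>] 0) (𝓝 (S.G * S.M₂ / a ^ 3)) := by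
    rw [← limit_sq_eq ha]
    refine tendsto_sq_of_abs_sub_le (by positivity) (.of_forall fun _ => norm_nonneg _)
      ((tendsto_h₁ a ρ).mul_const (a ^ 2))
      (ε := fun m₀ => ‖(S.field m₀ (z m₀)).pLam‖ * a + S.g₁ * (‖(S.field m₀ (z m₀)).lam‖ * a))
      (by simpa using (n2.mul_const a).add ((n1.mul_const a).const_mul S.g₁)) ?_
    filter_upwards [hE'] with m₀ ⟨hm₀, hρ, hl, hl2, hr, hΩ⟩
    have hb := abs_centrifugal_sub_le (p := (z m₀).pLam) (c := 1) (h := S.h₁ a m₀ ρ) hg₁ hΩ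
    rw [← gradLam_eq m₀ ha hρ hl hl2 hr, one_smul, hl, mul_one] at hb
    change |_| ≤ ‖(S.field m₀ (z m₀)).pLam‖ * a
      + S.g₁ * (‖(S.field m₀ (z m₀)).lam‖ * ‖S.Ω₀ (z m₀)‖ * a) at hb
    rw [mul_assoc]
    refine hb.trans ?_
    have : 0 ≤ ‖(S.field m₀ (z m₀)).pLam‖ * a * ‖S.Ω₀ (z m₀)‖ := by positivity
    have : 0 ≤ S.g₁ * (‖(S.field m₀ (z m₀)).lam‖ * a) := by positivity
    nlinarith
  have hdef : Tendsto (fun m₀ => S.M₂ / S.M₁ m₀ * (ρ + S.ν) * (a ^ 2 * ‖S.Ω₀ (z m₀)‖ ^ 2)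
      - S.pull a ρ * a ^ 2) (𝓝[>] 0) (𝓝 0) := by
    have hbound : Tendsto (fun m₀ => ‖(S.field m₀ (z m₀)).pMu‖ / m₀ * a
        + S.M₂ / S.M₁ m₀ * (‖(S.field m₀ (z m₀)).mu‖ * (1 + ‖S.Ω₀ (z m₀)‖ ^ 2) * a))
        (𝓝[>] 0) (𝓝 0) := by
      simpa using (n4.mul_const a).add
        (tendsto_mass_ratio.mul ((n3.mul (hsq.const_add 1)).mul_const a))
    refine squeeze_zero_norm' ?_ hbound
    filter_upwards [hE'] with m₀ ⟨hm₀, hρ, hl, hl2, hr, hΩ⟩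
    have hb := abs_centrifugal_sub_le (p := (z m₀).pMu) (c := ρ + S.ν) (h := m₀ * S.pull a ρ)
      (S.g₂_pos hm₀) hΩ
    rw [← gradMu_eq m₀ ha hρ hl hl2 hr, ← mu_eq hr, hl] at hb
    change |_| ≤ ‖(S.field m₀ (z m₀)).pMu‖ * a
      + S.g₂ m₀ * (‖(S.field m₀ (z m₀)).mu‖ * ‖S.Ω₀ (z m₀)‖ * a) at hb
    have hratio : 0 < S.M₂ / S.M₁ m₀ := div_pos S.M₂_pos (add_pos S.M₂_pos hm₀)
    rw [Real.norm_eq_abs]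
    rw [g₂_eq] at hb
    have hfac : m₀ * (S.M₂ / S.M₁ m₀) * (ρ + S.ν) * (a ^ 2 * ‖S.Ω₀ (z m₀)‖ ^ 2)
        - m₀ * S.pull a ρ * a ^ 2 = m₀ * (S.M₂ / S.M₁ m₀ * (ρ + S.ν)
          * (a ^ 2 * ‖S.Ω₀ (z m₀)‖ ^ 2) - S.pull a ρ * a ^ 2) := by ring
    rw [hfac, abs_mul, abs_of_pos hm₀] at hb
    have ht : ‖S.Ω₀ (z m₀)‖ ≤ 1 + ‖S.Ω₀ (z m₀)‖ ^ 2 := by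
      nlinarith [sq_nonneg (‖S.Ω₀ (z m₀)‖ - 1), norm_nonneg (S.Ω₀ (z m₀))]
    calc _ ≤ (‖(S.field m₀ (z m₀)).pMu‖ * a
          + m₀ * (S.M₂ / S.M₁ m₀) * (‖(S.field m₀ (z m₀)).mu‖ * ‖S.Ω₀ (z m₀)‖ * a)) / m₀ := by
          rw [le_div_iff₀' hm₀]; exact hb
      _ = ‖(S.field m₀ (z m₀)).pMu‖ / m₀ * a
          + S.M₂ / S.M₁ m₀ * (‖(S.field m₀ (z m₀)).mu‖ * ‖S.Ω₀ (z m₀)‖ * a) := by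
          field_simp
      _ ≤ _ := by gcongr
  have hlim := (((tendsto_mass_ratio (S := S)).mul_const (ρ + S.ν)).mul (hsq.const_mul (a ^ 2))).sub_const
    (S.pull a ρ * a ^ 2)
  have h := tendsto_nhds_unique hdef hlim
  have ha2 : a ^ 2 ≠ 0 := by positivity
  apply mul_right_cancel₀ ha2
  linarith

/-- Along the family every component of the field vanishes for small `m₀ > 0`, except that of `p_μ`,
which is `m₀` times the defect of the balance of forces, up to factors tending to `1`. -/
theorem isFirstOrderEulerian_eulerFamily {a ρ s : ℝ} (ha : 0 < a) (hρ : 0 < ρ)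
    (hs : s = 1 ∨ s = -1) (ω₁ ω₂ : ℝ) (h : (ρ + S.ν) * (S.G * S.M₂ / a ^ 3) = S.pull a ρ) :
    S.IsFirstOrderEulerian a ρ (S.eulerFamily a ρ s ω₁ ω₂) := by
  have hM := S.M₂_pos
  have hg₁ := S.g₁_pos
  have hm₁ := S.m₁_pos
  have hm₂ := S.m₂_pos
  have hG := S.G_pos
  have hmu : S.muAbs a ρ = (ρ + S.ν) * a := by
    unfold muAbs ν M₂ at *
    field_simp
    ring
  have hr : ∀ m₀, S.r₀₁ (S.eulerFamily a ρ s ω₁ ω₂ m₀).lam (S.eulerFamily a ρ s ω₁ ω₂ m₀).mu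
      = ρ • (S.eulerFamily a ρ s ω₁ ω₂ m₀).lam := by
    intro m₀
    ext i; fin_cases i <;> simp [r₀₁, eulerFamily, hmu, ν, M₂]
    ring
  have hnorm : ‖(!₂[a, 0, 0] : E3)‖ = a := by
    rw [← abs_of_pos ha, EuclideanSpace.norm_eq]
    simp [Fin.sum_univ_three, Real.sqrt_sq_eq_abs]
  have hΩ : ∀ m₀, S.Ω₀ (S.eulerFamily a ρ s ω₁ ω₂ m₀) = !₂[0, 0, S.ω₀ a ρ s m₀] := by
    intro m₀
    have := S.C₀_pos.ne'
    ext i; fin_cases i <;> simp [Ω₀, eulerFamily, diagAct]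
    field_simp
  have hgl : ∀ m₀, S.gradLam m₀ (S.eulerFamily a ρ s ω₁ ω₂ m₀).lam
      (S.eulerFamily a ρ s ω₁ ω₂ m₀).mu = S.h₁ a m₀ ρ • !₂[a, 0, 0] := fun m₀ =>
    gradLam_eq m₀ ha hρ hnorm (by simp [eulerFamily]) (hr m₀)
  have hgm : ∀ m₀, S.gradMu m₀ (S.eulerFamily a ρ s ω₁ ω₂ m₀).lam
      (S.eulerFamily a ρ s ω₁ ω₂ m₀).mu = (m₀ * S.pull a ρ) • !₂[a, 0, 0] := fun m₀ =>
    gradMu_eq m₀ ha hρ hnorm (by simp [eulerFamily]) (hr m₀)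
  have hω : ∀ᶠ m₀ in 𝓝[>] (0 : ℝ), S.ω₀ a ρ s m₀ ^ 2 = S.h₁ a m₀ ρ / S.g₁ := by
    -- `h₁` is positive for small `m₀`, so the square root in `ω₀` is not a junk value
    have hpos : 0 < S.G * S.m₁ * S.m₂ / a ^ 3 := by positivity
    filter_upwards [(tendsto_h₁ (S := S) a ρ).eventually (lt_mem_nhds hpos)] with m₀ hm₀
    have hs2 : s ^ 2 = 1 := by rcases hs with rfl | rfl <;> norm_num
    rw [ω₀, mul_pow, hs2, Real.sq_sqrt (by positivity), g₁, M₂]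
    field_simp
  refine ⟨.of_forall fun m₀ => ⟨hρ, hnorm, by simp [eulerFamily], hr m₀, ?_⟩, ?_, ?_, ?_, ?_, ?_,
    ?_, ?_⟩
  · rw [hΩ]
    simp [eulerFamily, PiLp.inner_apply, Fin.sum_univ_three]
  · refine (isLittleO_zero _ _).congr_left fun m₀ => ?_
    ext i; fin_cases i <;> simp [field, eulerFamily, cross, cross_apply, Ω₁, diagAct]
  · refine (isLittleO_zero _ _).congr_left fun m₀ => ?_
    ext i; fin_cases i <;> simp [field, eulerFamily, cross, cross_apply, Ω₂, diagAct]
  · refine (isLittleO_zero _ _).congr_left fun m₀ => ?_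
    simp only [field, hΩ, hgl, hgm]
    ext i; fin_cases i <;> simp [eulerFamily, cross, cross_apply]
  · refine (isLittleO_zero _ _).congr_left fun m₀ => ?_
    simp only [field, hΩ]
    ext i; fin_cases i <;> simp [eulerFamily, cross, cross_apply]
    field_simp
    ring
  · refine (isLittleO_zero _ _).congr' ?_ EventuallyEq.rfl
    filter_upwards [hω] with m₀ hm₀
    have hh : S.h₁ a m₀ ρ = S.g₁ * S.ω₀ a ρ s m₀ ^ 2 := by rw [hm₀]; field_simp
    simp only [field, hΩ, hgl, hh]
    ext i; fin_cases i <;> simp [eulerFamily, cross, cross_apply]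
    ring
  · refine (isLittleO_zero _ _).congr' ?_ EventuallyEq.rfl
    filter_upwards [eventually_mem_nhdsWithin] with m₀ hm₀
    have hg₂ := (S.g₂_pos hm₀).ne'
    simp only [field, hΩ]
    ext i; fin_cases i <;> simp [eulerFamily, cross, cross_apply]
    field_simp
    ring
  · -- the residue is `m₀` times a factor that tends to `0`
    have hlim : Tendsto (fun m₀ => (S.M₂ / S.M₁ m₀ * (S.h₁ a m₀ ρ / S.g₁) * S.muAbs a ρ
        - S.pull a ρ * a) • (!₂[1, 0, 0] : E3)) (𝓝[>] 0) (𝓝 0) := by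
      have := ((((tendsto_mass_ratio (S := S)).mul
        ((tendsto_h₁ (S := S) a ρ).div_const S.g₁)).mul_const
        (S.muAbs a ρ)).sub_const (S.pull a ρ * a)).smul_const (!₂[1, 0, 0] : E3)
      convert this using 2
      rw [← h, hmu, eq_comm]
      apply smul_eq_zero_of_left
      unfold g₁
      field_simp
      ring
    have ho : (fun m₀ : ℝ => m₀ • (S.M₂ / S.M₁ m₀ * (S.h₁ a m₀ ρ / S.g₁) * S.muAbs a ρ
        - S.pull a ρ * a) • (!₂[1, 0, 0] : E3)) =o[𝓝[>] 0] (fun m₀ => m₀) := by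
      have := (isBigO_refl (fun m₀ : ℝ => m₀) (𝓝[>] 0)).smul_isLittleO
        ((isLittleO_one_iff ℝ).mpr hlim)
      simpa using this
    refine ho.congr' ?_ EventuallyEq.rfl
    filter_upwards [hω] with m₀ hm₀
    rw [← hm₀]
    simp only [field, hΩ, hgm]
    ext i; fin_cases i <;> simp [eulerFamily, cross, cross_apply]
    rw [g₂_eq]
    ring

/-- Multiplying the balance of forces by `a⁵ ρ⁴ (1 + ρ)⁴ / G` gives the polynomial equation. -/
theorem balance_eq_zero_iff {a k ρ : ℝ} (ha : 0 < a) (hρ : 0 < ρ) (hk : S.β₁ = k * S.β₂) :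
    S.balance a k S.β₂ ρ = 0 ↔ (ρ + S.ν) * (S.G * S.M₂ / a ^ 3) = S.pull a ρ := by
  have hM : 0 < S.m₁ + S.m₂ := S.M₂_pos
  have hG := S.G_pos
  have hid : (ρ + S.ν) * (S.G * S.M₂ / a ^ 3) - S.pull a ρ
      = S.G / (a ^ 5 * ρ ^ 4 * (1 + ρ) ^ 4) * S.balance a k S.β₂ ρ := by
    unfold pull balance p₁ q₁ ν M₂
    rw [hk]
    have : 1 + ρ ≠ 0 := by positivity
    field_simp
    ring
  have hfac : S.G / (a ^ 5 * ρ ^ 4 * (1 + ρ) ^ 4) ≠ 0 := by positivity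
  rw [← sub_eq_zero (a := (ρ + S.ν) * _), hid, mul_eq_zero, or_iff_right hfac]

theorem eulerRatios_eq {a k : ℝ} (ha : 0 < a) (hk : S.β₁ = k * S.β₂) :
    S.eulerRatios a = S.balanceZeros a k S.β₂ := by
  ext ρ
  constructor
  · rintro ⟨z, hz⟩
    obtain ⟨m₀, hm₀⟩ := hz.1.exists
    exact ⟨hm₀.1, (balance_eq_zero_iff ha hm₀.1 hk).mpr (pull_eq_of_isFirstOrderEulerian ha hz)⟩
  · rintro ⟨hρ, h0⟩
    exact ⟨_, isFirstOrderEulerian_eulerFamily ha hρ (.inl rfl) 0 0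
      ((balance_eq_zero_iff ha hρ hk).mp h0)⟩

theorem hasExactlyFamilies_of_encard {a k : ℝ} {n : ℕ} (ha : 0 < a) (hk : S.β₁ = k * S.β₂)
    (h : (S.balanceZeros a k S.β₂).encard = n) : S.HasExactlyFamilies a n := by
  have he := eulerRatios_eq ha hk
  refine ⟨by rw [he, h], fun ρ hρ s hs ω₁ ω₂ => ?_⟩
  rw [he] at hρ
  exact isFirstOrderEulerian_eulerFamily ha hρ.1 hs ω₁ ω₂ ((balance_eq_zero_iff ha hρ.1 hk).mp hρ.2)

end GyrostatSystem

/-! ### Local extrema of `R₁` and bifurcations -/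

theorem not_isLocalMax_of_lt_right {f : ℝ → ℝ} {r : ℝ} (h : ∀ x, r < x → f r < f x) :
    ¬ IsLocalMax f r := by
  intro hmax
  have h1 : ∀ᶠ x in 𝓝[>] r, f x ≤ f r := hmax.filter_mono nhdsWithin_le_nhds
  obtain ⟨x, hx, hxr⟩ := (h1.and eventually_mem_nhdsWithin).exists
  exact absurd (h x hxr) (not_lt.mpr hx)

theorem not_isLocalMin_of_lt_left {f : ℝ → ℝ} {c r : ℝ} (hc : c < r)
    (h : ∀ x, c < x → x < r → f x < f r) : ¬ IsLocalMin f r := by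
  intro hmin
  have h1 : ∀ᶠ x in 𝓝[<] r, f r ≤ f x := hmin.filter_mono nhdsWithin_le_nhds
  obtain ⟨x, hx, hxr⟩ := (h1.and (Ioo_mem_nhdsLT hc)).exists
  exact absurd (h x hxr.1 hxr.2) (not_lt.mpr hx)

namespace GyrostatSystem

variable (S : GyrostatSystem)

theorem continuousAt_R₁ (a : ℝ) {k x : ℝ} (hq : q₁ k x ≠ 0) : ContinuousAt (S.R₁ a k) x := by
  have h1 := S.continuous_p₁
  have h2 := continuous_q₁ k
  have h3 : Continuous fun ρ => (S.m₁ + S.m₂) * a ^ 2 * ρ ^ 2 * (ρ + 1) ^ 2 * S.p₁ ρ := by fun_prop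
  exact h3.continuousAt.div h2.continuousAt hq

theorem R₁_sign_factor_pos {a x : ℝ} (ha : 0 < a) (hx : 0 < x) :
    0 < (S.m₁ + S.m₂) * a ^ 2 * x ^ 2 * (x + 1) ^ 2 := by
  have hm : 0 < S.m₁ + S.m₂ := S.M₂_pos
  positivity

variable {S} in
/-- A local extremum of `R₁` is below all other values of `R₁` where `q₁ > 0`. -/
theorem R₁_lt_of_q₁_pos {a k r x : ℝ} (ha : 0 < a) (hr : 0 < r) (hq : q₁ k r ≠ 0)
    (h : IsLocalExtr (S.R₁ a k) r) (hx : 0 < x) (hxr : x ≠ r) (hqx : 0 < q₁ k x) :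
    S.R₁ a k r < S.R₁ a k x := by
  have := (S.balance_pos_of_isLocalExtr ha hr hq h).2 x hx hxr
  rw [S.balance_eq hqx.ne'] at this
  linarith [pos_of_mul_pos_right this hqx.le]

variable {S} in
/-- A local extremum of `R₁` is above all other values of `R₁` where `q₁ < 0`. -/
theorem R₁_lt_of_q₁_neg {a k r x : ℝ} (ha : 0 < a) (hr : 0 < r) (hq : q₁ k r ≠ 0)
    (h : IsLocalExtr (S.R₁ a k) r) (hx : 0 < x) (hxr : x ≠ r) (hqx : q₁ k x < 0) :
    S.R₁ a k x < S.R₁ a k r := by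
  have := (S.balance_pos_of_isLocalExtr ha hr hq h).2 x hx hxr
  rw [S.balance_eq hqx.ne] at this
  linarith [neg_of_mul_pos_right this hqx.le]

theorem isLocalMin_of_isLocalExtr {a k r : ℝ} (ha : 0 < a) (hr : 0 < r) (hq : 0 < q₁ k r)
    (h : IsLocalExtr (S.R₁ a k) r) : IsLocalMin (S.R₁ a k) r := by
  filter_upwards [lt_mem_nhds hr, (continuous_q₁ k).continuousAt.eventually (lt_mem_nhds hq)]
    with x hx hqx
  rcases eq_or_ne x r with rfl | hxr
  · exact le_rfl
  · exact (R₁_lt_of_q₁_pos ha hr hq.ne' h hx hxr hqx).le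

theorem isLocalMax_of_isLocalExtr {a k r : ℝ} (ha : 0 < a) (hr : 0 < r) (hq : q₁ k r < 0)
    (h : IsLocalExtr (S.R₁ a k) r) : IsLocalMax (S.R₁ a k) r := by
  filter_upwards [lt_mem_nhds hr, (continuous_q₁ k).continuousAt.eventually (gt_mem_nhds hq)]
    with x hx hqx
  rcases eq_or_ne x r with rfl | hxr
  · exact le_rfl
  · exact (R₁_lt_of_q₁_neg ha hr hq.ne h hx hxr hqx).le

theorem encard_balanceZeros_of_isLocalExtr {a k r : ℝ} (ha : 0 < a) (hr : 0 < r) (hq : q₁ k r ≠ 0)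
    (h : IsLocalExtr (S.R₁ a k) r) : (S.balanceZeros a k (S.R₁ a k r)).encard = 1 := by
  rw [Set.encard_eq_one]
  refine ⟨r, Set.Subset.antisymm (fun x hx => ?_) ?_⟩
  · by_contra hxr
    exact ((S.balance_pos_of_isLocalExtr ha hr hq h).2 x hx.1 hxr).ne' hx.2
  · rintro _ rfl
    refine ⟨hr, ?_⟩
    rw [S.balance_eq hq, sub_self, mul_zero]

theorem encard_balanceZeros_eq_zero {a k b : ℝ} (h : ∀ x, 0 < x → S.balance a k b x ≠ 0) :
    (S.balanceZeros a k b).encard = 0 := by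
  rw [Set.encard_eq_zero]
  exact Set.eq_empty_of_forall_notMem fun x hx => h x hx.1 hx.2

theorem encard_balanceZeros_eq_two_of_ne {a k b x : ℝ} (ha : 0 < a) (hbk : b * k < 0) (hx : 0 < x)
    (hq : q₁ k x ≠ 0) (h : q₁ k x * (S.R₁ a k x - b) < 0) : (S.balanceZeros a k b).encard = 2 :=
  S.encard_balanceZeros_eq_two ha hbk hx (by rwa [S.balance_eq hq])

/-- `R₁` vanishes at `0` and at the zero of `p₁`, so Rolle's theorem applies. -/
theorem exists_isLocalExtr_R₁ {a k ρ₁ : ℝ} (hρ₁ : 0 < ρ₁) (hp : S.p₁ ρ₁ = 0)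
    (hq : ∀ x, 0 ≤ x → x ≤ ρ₁ → q₁ k x ≠ 0) :
    ∃ r, 0 < r ∧ r < ρ₁ ∧ IsLocalExtr (S.R₁ a k) r := by
  obtain ⟨r, hr, h⟩ := exists_isLocalExtr_Ioo (f := S.R₁ a k) hρ₁
    (fun x hx => (S.continuousAt_R₁ a (hq x hx.1 hx.2)).continuousWithinAt)
    (by simp [R₁, hp])
  exact ⟨r, hr.1, hr.2, h⟩

theorem bifurcation_of_pos {a k : ℝ} (ha : 0 < a) (hk : 0 < k) :
    ∃ r, IsOnlyLocalMin (S.R₁ a k) r ∧ S.R₁ a k r < 0 ∧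
      ∀ b, (b < S.R₁ a k r → (S.balanceZeros a k b).encard = 0) ∧
        (b = S.R₁ a k r → (S.balanceZeros a k b).encard = 1) ∧
        (S.R₁ a k r < b → b < 0 → (S.balanceZeros a k b).encard = 2) ∧
        (0 < b → (S.balanceZeros a k b).encard = 1) := by
  obtain ⟨ρ₁, hρ₁, hp⟩ := S.exists_p₁_eq_zero
  have hq : ∀ x, 0 ≤ x → 0 < q₁ k x := fun x hx => q₁_pos hk hx
  obtain ⟨r, hr, -, hext⟩ := S.exists_isLocalExtr_R₁ (a := a) hρ₁ hp fun x hx _ => (hq x hx).ne'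
  have hqr := hq r hr.le
  have hneg : S.R₁ a k r < 0 :=
    neg_of_mul_neg_left (S.balance_pos_of_isLocalExtr ha hr hqr.ne' hext).1 hk.le
  refine ⟨r, fun ρ => ⟨fun ⟨hρ, hmin⟩ => ?_, ?_⟩, hneg, fun b => ⟨fun hb => ?_, ?_, fun hb hb0 => ?_,
    fun hb => S.encard_balanceZeros_of_mul_pos ha (mul_pos hb hk)⟩⟩
  · by_contra hne
    exact lt_asymm (R₁_lt_of_q₁_pos ha hρ (hq ρ hρ.le).ne' (.inl hmin) hr (Ne.symm hne) hqr)
      (R₁_lt_of_q₁_pos ha hr hqr.ne' hext hρ hne (hq ρ hρ.le))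
  · rintro rfl
    exact ⟨hr, S.isLocalMin_of_isLocalExtr ha hr hqr hext⟩
  · refine S.encard_balanceZeros_eq_zero fun x hx => ?_
    rw [S.balance_eq (hq x hx.le).ne']
    refine (mul_pos (hq x hx.le) ?_).ne'
    rcases eq_or_ne x r with rfl | hxr
    · linarith
    · linarith [R₁_lt_of_q₁_pos ha hr hqr.ne' hext hx hxr (hq x hx.le)]
  · rintro rfl
    exact S.encard_balanceZeros_of_isLocalExtr ha hr hqr.ne' hext
  · exact S.encard_balanceZeros_eq_two_of_ne ha (mul_neg_of_neg_of_pos hb0 hk) hr hqr.ne'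
      (mul_neg_of_pos_of_neg hqr (by linarith))

/-- If the zero of `q₁` lies to the right of the zero `ρ₁` of `p₁`, then `R₁` has a local maximum
point in `(0, ρ₁)`, and no other. -/
theorem exists_isOnlyLocalMax {a k ρ₁ : ℝ} (ha : 0 < a) (hρ₁ : 0 < ρ₁) (hp : S.p₁ ρ₁ = 0)
    (hk : k < 0) (hq : q₁ k ρ₁ < 0) :
    ∃ r, 0 < r ∧ q₁ k r < 0 ∧ IsOnlyLocalMax (S.R₁ a k) r ∧ 0 < S.R₁ a k r := by
  have hq' : ∀ x, 0 ≤ x → x ≤ ρ₁ → q₁ k x < 0 := by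
    intro x hx hxρ
    rcases hxρ.eq_or_lt with rfl | hlt
    · exact hq
    · exact q₁_neg_of_lt hx hlt hq.le
  obtain ⟨r, hr, hrρ, hext⟩ := S.exists_isLocalExtr_R₁ (a := a) hρ₁ hp
    fun x hx hxρ => (hq' x hx hxρ).ne
  have hqr := hq' r hr.le hrρ.le
  refine ⟨r, hr, hqr, fun ρ => ⟨fun ⟨hρ, hmax⟩ => ?_, ?_⟩,
    pos_of_mul_neg_left (S.balance_pos_of_isLocalExtr ha hr hqr.ne hext).1 hk.le⟩
  · by_contra hne
    rcases lt_or_ge (q₁ k ρ) 0 with hqρ | hqρ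
    · exact lt_asymm (R₁_lt_of_q₁_neg ha hρ hqρ.ne (.inr hmax) hr (Ne.symm hne) hqr)
        (R₁_lt_of_q₁_neg ha hr hqr.ne hext hρ hne hqρ)
    · refine not_isLocalMax_of_lt_right (fun x hx => ?_) hmax
      have hx0 := hρ.trans hx
      have hqx := q₁_pos_of_lt hρ.le hx hqρ
      rcases hqρ.eq_or_lt with h0 | hlt
      · -- at the pole `R₁` has the value `0` by convention, and it is positive to the right
        have hlt : ρ₁ < x := by
          by_contra hcon
          exact absurd (hq' x hx0.le (not_lt.mp hcon)) (not_lt.mpr hqx.le)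
        have hpx := S.p₁_pos_of_lt hρ₁.le hlt hp.ge
        have h1 : S.R₁ a k ρ = 0 := by rw [R₁, ← h0, div_zero]
        rw [h1]
        exact div_pos (mul_pos (S.R₁_sign_factor_pos ha hx0) hpx) hqx
      · exact R₁_lt_of_q₁_pos ha hρ hlt.ne' (.inr hmax) hx0 hx.ne' hqx
  · rintro rfl
    exact ⟨hr, S.isLocalMax_of_isLocalExtr ha hr hqr hext⟩

/-- If the zero of `q₁` lies to the right of the zero of `p₁`, a local minimum point can lie only where
`q₁ > 0`. -/
theorem not_isLocalMin_of_q₁_nonpos {a k ρ ρ₁ : ℝ} (ha : 0 < a) (hρ₁ : 0 < ρ₁) (hp : S.p₁ ρ₁ = 0)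
    (hq : q₁ k ρ₁ < 0) (hρ : 0 < ρ) (hqρ : q₁ k ρ ≤ 0) : ¬ IsLocalMin (S.R₁ a k) ρ := by
  intro hmin
  rcases hqρ.eq_or_lt with h0 | hlt
  · -- at the pole `R₁` has the value `0` by convention, and it is negative on `(ρ₁, ρ)`
    have hlt : ρ₁ < ρ := by
      by_contra hcon
      rcases (not_lt.mp hcon).eq_or_lt with rfl | h
      · exact hq.ne h0
      · exact (q₁_neg_of_lt hρ.le h hq.le).ne h0
    refine not_isLocalMin_of_lt_left hlt (fun x hx hxρ => ?_) hmin
    have hx0 := hρ₁.trans hx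
    have hpx := S.p₁_pos_of_lt hρ₁.le hx hp.ge
    have h1 : S.R₁ a k ρ = 0 := by rw [R₁, h0, div_zero]
    rw [h1]
    exact div_neg_of_pos_of_neg (mul_pos (S.R₁_sign_factor_pos ha hx0) hpx)
      (q₁_neg_of_lt hx0.le hxρ hqρ)
  · exact not_isLocalMin_of_lt_left (f := S.R₁ a k) hρ
      (fun x hx hxρ => R₁_lt_of_q₁_neg ha hρ hlt.ne (.inl hmin) hx hxρ.ne
        (q₁_neg_of_lt hx.le hxρ hqρ)) hmin

/-- If the zero of `q₁` exists and lies to the right of the zero of `p₁`, then `R₁` has a local minimum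
point beyond it, and no other. -/
theorem exists_isOnlyLocalMin {a k ρ₁ : ℝ} (ha : 0 < a) (hρ₁ : 0 < ρ₁) (hp : S.p₁ ρ₁ = 0)
    (hk1 : -1 < k) (hk : k < 0) (hq : q₁ k ρ₁ < 0) :
    ∃ r, 0 < r ∧ 0 < q₁ k r ∧ IsOnlyLocalMin (S.R₁ a k) r := by
  obtain ⟨c, hc, hqc⟩ := exists_q₁_eq_zero hk1 hk
  have hcρ : ρ₁ < c := by
    by_contra hcon
    rcases (not_lt.mp hcon).eq_or_lt with rfl | h
    · exact hq.ne hqc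
    · exact (q₁_neg_of_lt hc.le h hq.le).ne hqc
  have hqpos : ∀ x, c < x → 0 < q₁ k x := fun x hx => q₁_pos_of_lt hc.le hx hqc.ge
  -- `R₁` takes the value `b` on both sides of `c + 1`, since it tends to `∞` at both ends of `(c, ∞)`
  set b := S.R₁ a k (c + 1) + 1 with hb
  have hcneg : S.balance a k b (c + 1) < 0 := by
    have := hqpos (c + 1) (by linarith)
    rw [S.balance_eq this.ne']
    exact mul_neg_of_pos_of_neg this (by linarith)
  have hcpos : 0 < S.balance a k b c := by
    rw [balance, hqc, mul_zero, sub_zero]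
    exact mul_pos (S.R₁_sign_factor_pos ha hc) (S.p₁_pos_of_lt hρ₁.le hcρ hp.ge)
  obtain ⟨X, hX, hXpos⟩ := S.exists_balance_pos ha k b
  have hcX : c + 1 ≤ X := by
    by_contra hcon
    exact absurd (hXpos _ (not_le.mp hcon).le) (not_lt.mpr hcneg.le)
  obtain ⟨u, hu, hu0⟩ := intermediate_value_Icc' (by linarith : c ≤ c + 1)
    (S.continuous_balance a k b).continuousOn ⟨hcneg.le, hcpos.le⟩
  obtain ⟨v, hv, hv0⟩ := intermediate_value_Icc hcX
    (S.continuous_balance a k b).continuousOn ⟨hcneg.le, (hXpos X le_rfl).le⟩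
  have hcu : c < u := lt_of_le_of_ne hu.1 (by rintro rfl; exact hcpos.ne' hu0)
  have huc : u < c + 1 := lt_of_le_of_ne hu.2 (by rintro rfl; exact hcneg.ne hu0)
  have hval : ∀ x, c < x → S.balance a k b x = 0 → S.R₁ a k x = b := by
    intro x hx h0
    rw [S.balance_eq (hqpos x hx).ne', mul_eq_zero, or_iff_right (hqpos x hx).ne'] at h0
    linarith
  have huv : u < v := huc.trans_le hv.1
  obtain ⟨r, hr, hext⟩ := exists_isLocalExtr_Ioo (f := S.R₁ a k) huv
    (fun x hx => (S.continuousAt_R₁ a (hqpos x (hcu.trans_le hx.1)).ne').continuousWithinAt)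
    (by rw [hval u hcu hu0, hval v (hcu.trans huv) hv0])
  have hcr : c < r := hcu.trans hr.1
  have hr0 : 0 < r := hc.trans hcr
  have hqr := hqpos r hcr
  refine ⟨r, hr0, hqr, fun ρ => ⟨fun ⟨hρ, hmin⟩ => ?_, ?_⟩⟩
  · by_contra hne
    rcases le_or_gt (q₁ k ρ) 0 with hqρ | hqρ
    · exact S.not_isLocalMin_of_q₁_nonpos ha hρ₁ hp hq hρ hqρ hmin
    · exact lt_asymm (R₁_lt_of_q₁_pos ha hρ hqρ.ne' (.inl hmin) hr0 (Ne.symm hne) hqr)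
        (R₁_lt_of_q₁_pos ha hr0 hqr.ne' hext hρ hne hqρ)
  · rintro rfl
    exact ⟨hr0, S.isLocalMin_of_isLocalExtr ha hr0 hqr hext⟩

/-- Where `p₁` and `q₁` have no common zero, the equation `R₁ = b` has no solutions if `b` exceeds the
values of `R₁` where `q₁ < 0` and is exceeded by those where `q₁ > 0`. -/
theorem encard_balanceZeros_eq_zero_of_between {a k b ρ₁ : ℝ} (ha : 0 < a) (hρ₁ : 0 < ρ₁)
    (hp : S.p₁ ρ₁ = 0) (hq : q₁ k ρ₁ < 0) (hneg : ∀ x, 0 < x → q₁ k x < 0 → S.R₁ a k x < b)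
    (hpos : ∀ x, 0 < x → 0 < q₁ k x → b < S.R₁ a k x) : (S.balanceZeros a k b).encard = 0 := by
  refine S.encard_balanceZeros_eq_zero fun x hx h0 => ?_
  rcases lt_trichotomy (q₁ k x) 0 with h | h | h
  · rw [S.balance_eq h.ne] at h0
    have := mul_pos_of_neg_of_neg h (sub_neg.mpr (hneg x hx h))
    linarith
  · have hlt : ρ₁ < x := by
      by_contra hcon
      rcases (not_lt.mp hcon).eq_or_lt with rfl | h'
      · exact hq.ne h
      · exact (q₁_neg_of_lt hx.le h' hq.le).ne h
    rw [balance, h, mul_zero, sub_zero] at h0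
    exact (mul_pos (S.R₁_sign_factor_pos ha hx) (S.p₁_pos_of_lt hρ₁.le hlt hp.ge)).ne' h0
  · rw [S.balance_eq h.ne'] at h0
    have := mul_pos h (sub_pos.mpr (hpos x hx h))
    linarith

end GyrostatSystem

end

theorem proposition6 (S : GyrostatSystem) (a : ℝ) (ha : 0 < a) (k : ℝ)
    (hk : S.β₁ = k * S.β₂) :
    ∃ k₀ : ℝ,
      -- `k₀` is the only value of `k` for which `p₁` and `q₁` have a common root in `(0, ∞)`
      (∀ k' : ℝ, (∃ ρ : ℝ, 0 < ρ ∧ S.p₁ ρ = 0 ∧ q₁ k' ρ = 0) ↔ k' = k₀) ∧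
      -1 < k₀ ∧ k₀ < 0 ∧
      -- a)
      (0 < k → ∃ ρmin ξ₂ : ℝ, IsOnlyLocalMin (S.R₁ a k) ρmin ∧ ξ₂ = S.R₁ a k ρmin ∧ ξ₂ < 0 ∧
        (S.β₂ < ξ₂ → S.HasExactlyFamilies a 0) ∧
        (S.β₂ = ξ₂ → S.HasExactlyFamilies a 1) ∧
        (ξ₂ < S.β₂ → S.β₂ < 0 → S.HasExactlyFamilies a 2) ∧
        (0 < S.β₂ → S.HasExactlyFamilies a 1)) ∧
      -- b), when `R₁` has a local minimum
      (-1 < k → k < k₀ → ∃ ρmax ρmin ξ₁ ξ₂ : ℝ,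
        IsOnlyLocalMax (S.R₁ a k) ρmax ∧ IsOnlyLocalMin (S.R₁ a k) ρmin ∧
        ξ₁ = S.R₁ a k ρmax ∧ ξ₂ = S.R₁ a k ρmin ∧ 0 < ξ₁ ∧ ξ₁ < ξ₂ ∧
        (ξ₁ < S.β₂ → S.β₂ < ξ₂ → S.HasExactlyFamilies a 0) ∧
        (S.β₂ = ξ₁ ∨ S.β₂ = ξ₂ → S.HasExactlyFamilies a 1) ∧
        (ξ₂ < S.β₂ → S.HasExactlyFamilies a 2) ∧
        (0 < S.β₂ → S.β₂ < ξ₁ → S.HasExactlyFamilies a 2)) ∧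
      -- b), when `R₁` has no local minimum (that is, with `ξ₂ = +∞`)
      (k ≤ -1 → ∃ ρmax ξ₁ : ℝ,
        IsOnlyLocalMax (S.R₁ a k) ρmax ∧ (∀ ρ : ℝ, 0 < ρ → ¬ IsLocalMin (S.R₁ a k) ρ) ∧
        ξ₁ = S.R₁ a k ρmax ∧ 0 < ξ₁ ∧
        (ξ₁ < S.β₂ → S.HasExactlyFamilies a 0) ∧
        (S.β₂ = ξ₁ → S.HasExactlyFamilies a 1) ∧
        (0 < S.β₂ → S.β₂ < ξ₁ → S.HasExactlyFamilies a 2)) ∧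
      -- c)
      (k < k₀ → S.β₂ < 0 → S.HasExactlyFamilies a 1) ∧
      -- d)
      (k₀ < k → k < 0 → 0 < S.β₂ → S.HasExactlyFamilies a 2) ∧
      -- e)
      (k₀ < k → k < 0 → S.β₂ < 0 → S.HasExactlyFamilies a 1) := by
  open GyrostatSystem in
  obtain ⟨ρ₁, hρ₁, hp⟩ := S.exists_p₁_eq_zero
  have hroot : ∀ ρ, 0 < ρ → S.p₁ ρ = 0 → ρ = ρ₁ := by
    intro ρ hρ h0
    rcases lt_trichotomy ρ ρ₁ with h | h | h
    · exact absurd (S.p₁_neg_of_lt hρ.le h hp.le) h0.not_lt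
    · exact h
    · exact absurd (S.p₁_pos_of_lt hρ₁.le h hp.ge) h0.not_gt
  have h0 : ∀ {k b : ℝ}, (S.balanceZeros a k b).encard = 0 →
      (S.balanceZeros a k b).encard = ((0 : ℕ) : ℕ∞) := fun h => by simpa using h
  have h1 : ∀ {k b : ℝ}, (S.balanceZeros a k b).encard = 1 →
      (S.balanceZeros a k b).encard = ((1 : ℕ) : ℕ∞) := fun h => by simpa using h
  have h2 : ∀ {k b : ℝ}, (S.balanceZeros a k b).encard = 2 →
      (S.balanceZeros a k b).encard = ((2 : ℕ) : ℕ∞) := fun h => by simpa using h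
  have hone : k < 0 → S.β₂ < 0 → S.HasExactlyFamilies a 1 := fun hk' hβ =>
    hasExactlyFamilies_of_encard ha hk
      (h1 (S.encard_balanceZeros_of_mul_pos ha (mul_pos_of_neg_of_neg hβ hk')))
  have ht0 : 0 < ρ₁ / (1 + ρ₁) := by positivity
  have ht1 : ρ₁ / (1 + ρ₁) < 1 := by rw [div_lt_one (by positivity)]; linarith
  have ht4 : (ρ₁ / (1 + ρ₁)) ^ 4 < 1 := pow_lt_one₀ ht0.le ht1 (by norm_num)
  have hk₀ : -(ρ₁ / (1 + ρ₁)) ^ 4 < 0 := by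
    have : 0 < (ρ₁ / (1 + ρ₁)) ^ 4 := by positivity
    linarith
  refine ⟨-(ρ₁ / (1 + ρ₁)) ^ 4, fun k' => ⟨?_, fun h => ⟨ρ₁, hρ₁, hp, (q₁_eq_zero_iff hρ₁.le).mpr h⟩⟩,
    by linarith, hk₀, fun hkpos => ?_, fun hk1 hkk => ?_, fun hk1 => ?_,
    fun hkk hβ => hone (hkk.trans hk₀) hβ, fun hkk hk0 hβ => ?_, fun _ hk0 hβ => hone hk0 hβ⟩
  · rintro ⟨ρ, hρ, hpρ, hqρ⟩
    rw [hroot ρ hρ hpρ, q₁_eq_zero_iff hρ₁.le] at hqρ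
    exact hqρ
  · obtain ⟨r, honly, hneg, hcount⟩ := S.bifurcation_of_pos ha hkpos
    obtain ⟨c0, c1, c2, c3⟩ := hcount S.β₂
    exact ⟨r, _, honly, rfl, hneg, fun h => hasExactlyFamilies_of_encard ha hk (h0 (c0 h)),
      fun h => hasExactlyFamilies_of_encard ha hk (h1 (c1 h)),
      fun h h' => hasExactlyFamilies_of_encard ha hk (h2 (c2 h h')),
      fun h => hasExactlyFamilies_of_encard ha hk (h1 (c3 h))⟩
  · have hk0 := hkk.trans hk₀
    have hq := (q₁_neg_iff hρ₁.le).mpr hkk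
    obtain ⟨r, hr, hqr, hmax, hpos⟩ := S.exists_isOnlyLocalMax ha hρ₁ hp hk0 hq
    obtain ⟨t, ht, hqt, hmin⟩ := S.exists_isOnlyLocalMin ha hρ₁ hp hk1 hk0 hq
    have her : IsLocalExtr (S.R₁ a k) r := .inr ((hmax r).mpr rfl).2
    have het : IsLocalExtr (S.R₁ a k) t := .inl ((hmin t).mpr rfl).2
    have hrt : t ≠ r := by rintro rfl; exact lt_asymm hqt hqr
    have hξ := R₁_lt_of_q₁_pos ha hr hqr.ne her ht hrt hqt
    refine ⟨r, t, _, _, hmax, hmin, rfl, rfl, hpos, hξ, fun hb1 hb2 => ?_, ?_, fun hb => ?_,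
      fun hb hb1 => ?_⟩
    · refine hasExactlyFamilies_of_encard ha hk (h0 (S.encard_balanceZeros_eq_zero_of_between ha hρ₁ hp
        hq (fun x hx hqx => ?_) fun x hx hqx => ?_))
      · rcases eq_or_ne x r with rfl | hxr
        · exact hb1
        · exact (R₁_lt_of_q₁_neg ha hr hqr.ne her hx hxr hqx).trans hb1
      · rcases eq_or_ne x t with rfl | hxt
        · exact hb2
        · exact hb2.trans (R₁_lt_of_q₁_pos ha ht hqt.ne' het hx hxt hqx)
    · rintro (hb | hb) <;> refine hasExactlyFamilies_of_encard ha hk (h1 ?_) <;> rw [hb]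
      · exact S.encard_balanceZeros_of_isLocalExtr ha hr hqr.ne her
      · exact S.encard_balanceZeros_of_isLocalExtr ha ht hqt.ne' het
    · exact hasExactlyFamilies_of_encard ha hk (h2 (S.encard_balanceZeros_eq_two_of_ne ha
        (mul_neg_of_pos_of_neg (by linarith) hk0) ht hqt.ne'
        (mul_neg_of_pos_of_neg hqt (by linarith))))
    · exact hasExactlyFamilies_of_encard ha hk (h2 (S.encard_balanceZeros_eq_two_of_ne ha
        (mul_neg_of_pos_of_neg hb hk0) hr hqr.ne (mul_neg_of_neg_of_pos hqr (by linarith))))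
  · have hk0 : k < 0 := by linarith
    have hqneg : ∀ x, 0 < x → q₁ k x < 0 := fun x hx => q₁_neg_of_le_neg_one hk1 hx.le
    have hq := hqneg ρ₁ hρ₁
    obtain ⟨r, hr, hqr, hmax, hpos⟩ := S.exists_isOnlyLocalMax ha hρ₁ hp hk0 hq
    have her : IsLocalExtr (S.R₁ a k) r := .inr ((hmax r).mpr rfl).2
    refine ⟨r, _, hmax, fun ρ hρ => S.not_isLocalMin_of_q₁_nonpos ha hρ₁ hp hq hρ (hqneg ρ hρ).le,
      rfl, hpos, fun hb => ?_, fun hb => ?_, fun hb hb1 => ?_⟩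
    · refine hasExactlyFamilies_of_encard ha hk (h0 (S.encard_balanceZeros_eq_zero_of_between ha hρ₁ hp
        hq (fun x hx hqx => ?_) fun x hx hqx => absurd (hqneg x hx) (not_lt.mpr hqx.le)))
      rcases eq_or_ne x r with rfl | hxr
      · exact hb
      · exact (R₁_lt_of_q₁_neg ha hr hqr.ne her hx hxr hqx).trans hb
    · refine hasExactlyFamilies_of_encard ha hk (h1 ?_)
      rw [hb]
      exact S.encard_balanceZeros_of_isLocalExtr ha hr hqr.ne her
    · exact hasExactlyFamilies_of_encard ha hk (h2 (S.encard_balanceZeros_eq_two_of_ne ha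
        (mul_neg_of_pos_of_neg hb hk0) hr hqr.ne (mul_neg_of_neg_of_pos hqr (by linarith))))
  · -- at the zero of `p₁`, the function `balance` has the value `-β₂ q₁ < 0`
    refine hasExactlyFamilies_of_encard ha hk (h2 (S.encard_balanceZeros_eq_two (x := ρ₁) ha
      (mul_neg_of_pos_of_neg hβ hk0) hρ₁ ?_))
    have hq := (q₁_pos_iff hρ₁.le).mpr hkk
    rw [balance, hp, mul_zero, zero_sub, neg_lt_zero]
    exact mul_pos hβ hq
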